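/- **Setting (SRAMF with a sample-average objective).** There are finite sets of vehicles $S_A$ (augmented supply, $|S_A|=n_A$) and $S_B$ (basis supply, $|S_B|=n_B$); vehicle $i$ has a capacity $C_i\in\mathbb N$, and $p=1+\max_{i\in S_A\cup S_B}C_i$. There are a budget $K$ with $1\le K\le n_A$ and $N\ge 1$ scenarios. Scenario $\xi$ has a finite set $D(\xi)$ of requests, request $j$ having $w_j\ge 1$ passengers, and a finite family $E(\xi)$ of hyperedges (trips). A trip $e$ consists of one vehicle $i$ and a nonempty set $J\subseteq D(\xi)$ with $\sum_{j\in J}w_j\le C_i$, and has a value $v_e\ge 0$. For $S\subseteq S_A$ let $\hat v(S,\xi)$ be the optimal value of the linear program $$\max \sum_{e\in E(\xi)}v_ex_e\quad\text{s.t.}\quad \sum_{e\ni j}x_e\le 1\ (j\in D(\xi)),\quad \sum_{e\ni i}x_e\le 1\ (i\in S_A\cup S_B),\quad x_e=0 \text{ if the vehicle of } e \text{ is in } S_A\setminus S,\quad x\ge 0,$$ and let $v(S,\xi)$ be its optimal value over $x\in\{0,1\}^{E(\xi)}$. Put $\hat v(S)=\frac1N\sum_\xi\hat v(S,\xi)$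 and $v^*(S)=\frac1N\sum_\xi v(S,\xi)$. SRAMF asks to maximize $v^*(S)$ over $S\subseteq S_A$ with $|S|\le K$. **Algorithm LSLPR**, with $\epsilon=\frac1{pK^2}$. Start from any $S_0\subseteq S_A$ with $|S_0|=K$. While there are $i\in S$ and $i'\in S_A\setminus S$ with $\hat v(S-i+i')>(1+\epsilon)\,\hat v(S)$, replace $S$ by such a set $S-i+i'$ (for instance the best one). When no such swap exists, halt the local search with $S_R=S$, and in each scenario $\xi$ choose a set $A_\xi$ of pairwise disjoint trips greedily: go through the trips of $E(\xi)$ whose vehicle is in $S_R\cup S_B$ in an order of decreasing values, and keep each trip that is disjoint from those kept before. **Theorem.** LSLPR is a polynomial-time $\frac1{p^2}$-approximation algorithm for SRAMF. Precisely: 1. *(Ratio.)* For every instance with real values and every output $(S_R,(A_\xi)_\xi)$ of LSLPR (whatever the start, the order of the swaps and the tie-breaking): $|S_R|=K$; each $A_\xi$ is a feasible integral assignment for $S_R$ in scenario $\xi$; and for every $S'\subseteq S_A$ with $|S'|\le K$, $$\hat v(S_R)\ \ge\ \frac1p\,\hat v(S'),\qquad \frac1N\sum_\xi\sum_{e\in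 A_\xi}v_e\ \ge\ \frac1{p^2}\,v^*(S').$$ 2. *(Iterations.)* If $0<v_{\min}\le v_{\max}$, every positive value is at least $v_{\min}$, and every value is at most $v_{\max}$, then the local search makes at most $1+\log_{1+\epsilon}\frac{N(n_A+n_B)v_{\max}}{v_{\min}}$ swaps. 3. *(Running time.)* Let the values be rational, and let LSLPR always take a best swap and evaluate $\hat v$ by calling an LP algorithm (one that returns the optimal value of every linear program with rational data that has a rational optimal value, and whose running time includes the time for writing down this value) once per scenario. For every polynomial $q$ there is a polynomial $P$ such that, with any LP algorithm whose running time is at most $q$ of the encoding length of the linear program, LSLPR halts from every start after at most $P(L)$ bit operations, and its result is an output as in part 1. Here $L$ is the sum of $p$, $n_A$, $n_B$, $N$ and the encoding lengths of the scenarios (requests, trips and values). -/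

import Mathlib

open scoped BigOperators

namespace SRAMF

/-- An instance of stochastic ride-pooling assignment with mixed fleets, with `N` sampled scenarios.
Vehicles are `Fin nA ⊕ Fin nB` (augmented supply, basis supply); scenario `ξ` has the requests
`Fin (nD ξ)` and the hyperedges (trips) `Fin (nE ξ)`. A trip consists of one vehicle and a nonempty
set of requests whose passengers fit into the vehicle, and it has a nonnegative value. -/
structure Instance (R : Type) [Zero R] [LE R] where
  nA : ℕ
  nB : ℕ
  /-- the budget: at most `K` augmented vehicles may be selected -/
  K : ℕ
  K_pos : 0 < K
  K_le : K ≤ nA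
  /-- the number of scenarios -/
  N : ℕ
  N_pos : 0 < N
  cap : Fin nA ⊕ Fin nB → ℕ
  nD : Fin N → ℕ
  passengers : ∀ ξ, Fin (nD ξ) → ℕ
  passengers_pos : ∀ ξ j, 0 < passengers ξ j
  nE : Fin N → ℕ
  vehicle : ∀ ξ, Fin (nE ξ) → Fin nA ⊕ Fin nB
  requests : ∀ ξ, Fin (nE ξ) → Finset (Fin (nD ξ))
  requests_nonempty : ∀ ξ e, (requests ξ e).Nonempty
  fits : ∀ ξ e, ∑ j ∈ requests ξ e, passengers ξ j ≤ cap (vehicle ξ e)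
  value : ∀ ξ, Fin (nE ξ) → R
  value_nonneg : ∀ ξ e, 0 ≤ value ξ e

namespace Instance

section Common

variable {R : Type} [Zero R] [LE R] (I : Instance R)

/-- `p` is one plus the largest vehicle capacity. -/
def p : ℕ := 1 + Finset.univ.sup I.cap

/-- The tolerance `ε = 1 / (p K²)` of the stopping rule. -/
def eps : ℚ := 1 / ((I.p : ℚ) * (I.K : ℚ) ^ 2)

/-- When the augmented vehicles in `S` are selected, trip `e` may be used if and only if its vehicle
is a basis vehicle or belongs to `S`. -/
def Available (S : Finset (Fin I.nA)) (ξ : Fin I.N) (e : Fin (I.nE ξ)) : Prop :=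
  ∀ i, I.vehicle ξ e = Sum.inl i → i ∈ S

instance (S : Finset (Fin I.nA)) (ξ : Fin I.N) (e : Fin (I.nE ξ)) :
    Decidable (I.Available S ξ e) :=
  inferInstanceAs (Decidable (∀ i, I.vehicle ξ e = Sum.inl i → i ∈ S))

/-- Two trips of a scenario are disjoint as hyperedges. -/
def DisjointTrips (ξ : Fin I.N) (e f : Fin (I.nE ξ)) : Prop :=
  I.vehicle ξ e ≠ I.vehicle ξ f ∧ Disjoint (I.requests ξ e) (I.requests ξ f)

instance (ξ : Fin I.N) (e f : Fin (I.nE ξ)) : Decidable (I.DisjointTrips ξ e f) :=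
  inferInstanceAs (Decidable (_ ∧ _))

/-- The solution `S - i + i'` obtained by swapping one vehicle. -/
def swap (S : Finset (Fin I.nA)) (i i' : Fin I.nA) : Finset (Fin I.nA) :=
  insert i' (S.erase i)

/-- Scan a list of trips, keeping each trip that is disjoint from all the trips kept so far
(which are listed in `c`). -/
def greedyScan (ξ : Fin I.N) : List (Fin (I.nE ξ)) → List (Fin (I.nE ξ)) → List (Fin (I.nE ξ))
  | [], c => c
  | e :: l, c =>
    if ∀ f ∈ c, I.DisjointTrips ξ e f then greedyScan ξ l (e :: c) else greedyScan ξ l c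

end Common

/-! ### The optimization problem and the local-search algorithm -/

section Real

variable (I : Instance ℝ)

/-- The constraints of the assignment LP of scenario `ξ` for the selected set `S`. -/
structure Feasible (S : Finset (Fin I.nA)) (ξ : Fin I.N) (x : Fin (I.nE ξ) → ℝ) : Prop where
  nonneg : ∀ e, 0 ≤ x e
  request_le : ∀ j, ∑ e with j ∈ I.requests ξ e, x e ≤ 1
  vehicle_le : ∀ i, ∑ e with I.vehicle ξ e = i, x e ≤ 1
  eq_zero : ∀ e, ¬ I.Available S ξ e → x e = 0

/-- The total value of a (fractional) assignment. -/
def assignmentValue (ξ : Fin I.N) (x : Fin (I.nE ξ) → ℝ) : ℝ := ∑ e, I.value ξ e * x e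

/-- The LP value of scenario `ξ`. -/
noncomputable def lpValue (S : Finset (Fin I.nA)) (ξ : Fin I.N) : ℝ :=
  sSup {t | ∃ x, I.Feasible S ξ x ∧ t = I.assignmentValue ξ x}

/-- The optimal value of an integral assignment in scenario `ξ`. -/
noncomputable def ipValue (S : Finset (Fin I.nA)) (ξ : Fin I.N) : ℝ :=
  sSup {t | ∃ x, I.Feasible S ξ x ∧ (∀ e, x e = 0 ∨ x e = 1) ∧ t = I.assignmentValue ξ x}

/-- `v̂(S)`: the sample average of the LP values. -/
noncomputable def vHat (S : Finset (Fin I.nA)) : ℝ := 1 / (I.N : ℝ) * ∑ ξ, I.lpValue S ξ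

/-- `v*(S)`: the sample average of the optimal integral values; this is the objective of SRAMF. -/
noncomputable def vStar (S : Finset (Fin I.nA)) : ℝ := 1 / (I.N : ℝ) * ∑ ξ, I.ipValue S ξ

/-- A swap of one vehicle that raises the LP value by a factor of more than `1 + ε`. -/
def ImprovingSwap (ε : ℝ) (S S' : Finset (Fin I.nA)) : Prop :=
  ∃ i ∈ S, ∃ i', i' ∉ S ∧ S' = I.swap S i i' ∧ (1 + ε) * I.vHat S < I.vHat S'

/-- `A` is obtained by the greedy algorithm: go through the available trips in an order of
decreasing values (ties in any order) and keep those disjoint from the trips kept before. -/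
def IsGreedy (S : Finset (Fin I.nA)) (ξ : Fin I.N) (A : Finset (Fin (I.nE ξ))) : Prop :=
  ∃ l : List (Fin (I.nE ξ)), l.Nodup ∧ (∀ e, e ∈ l ↔ I.Available S ξ e) ∧
    l.Pairwise (fun e f => I.value ξ f ≤ I.value ξ e) ∧ A = (I.greedyScan ξ l []).toFinset

/-- `(S, A)` is an output of the algorithm LSLPR with tolerance `ε`, started from `S₀`: improving
swaps, in any order, lead from `S₀` to `S`, no improving swap is possible at `S`, and in each
scenario `A` is the result of the greedy algorithm. -/
structure IsOutput (ε : ℝ) (S₀ S : Finset (Fin I.nA)) (A : ∀ ξ, Finset (Fin (I.nE ξ))) :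
    Prop where
  card_start : S₀.card = I.K
  path : Relation.ReflTransGen (I.ImprovingSwap ε) S₀ S
  halted : ∀ S', ¬ I.ImprovingSwap ε S S'
  greedy : ∀ ξ, I.IsGreedy S ξ (A ξ)

/-- The integral assignment given by a set of trips. -/
def indicator (ξ : Fin I.N) (A : Finset (Fin (I.nE ξ))) : Fin (I.nE ξ) → ℝ :=
  fun e => if e ∈ A then 1 else 0

/-- The sample average of the values of the integral assignments `A ξ`. -/
noncomputable def outputValue (A : ∀ ξ, Finset (Fin (I.nE ξ))) : ℝ :=
  1 / (I.N : ℝ) * ∑ ξ, I.assignmentValue ξ (I.indicator ξ (A ξ))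

end Real

/-- A rational instance, regarded as a real one. -/
noncomputable def toReal (I : Instance ℚ) : Instance ℝ where
  nA := I.nA
  nB := I.nB
  K := I.K
  K_pos := I.K_pos
  K_le := I.K_le
  N := I.N
  N_pos := I.N_pos
  cap := I.cap
  nD := I.nD
  passengers := I.passengers
  passengers_pos := I.passengers_pos
  nE := I.nE
  vehicle := I.vehicle
  requests := I.requests
  requests_nonempty := I.requests_nonempty
  fits := I.fits
  value := fun ξ e => (I.value ξ e : ℝ)
  value_nonneg := fun ξ e => by exact_mod_cast I.value_nonneg ξ e

end Instance

/-! ### Computations with a step count -/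

/-- A result together with the number of steps spent on computing it. -/
structure Timed (α : Type) where
  val : α
  time : ℕ

namespace Timed

instance : Monad Timed where
  pure a := ⟨a, 0⟩
  bind m f := ⟨(f m.val).val, m.time + (f m.val).time⟩

/-- Spend `n` steps. -/
def tick (n : ℕ) : Timed Unit := ⟨(), n⟩

/-- Compute the entries of a table one after the other. -/
def table {n : ℕ} {β : Fin n → Type} (f : ∀ i, Timed (β i)) : Timed (∀ i, β i) :=
  ⟨fun i => (f i).val, ∑ i, ((f i).time + 1)⟩

/-- Apply a computation to the members of a list one after the other. -/
def forList {α β : Type} (f : α → Timed β) : List α → Timed (List β)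
  | [] => pure []
  | a :: l => do
    tick 1
    let b ← f a
    let bs ← forList f l
    pure (b :: bs)

end Timed


/-- The binary length of a rational number. -/
def bits (q : ℚ) : ℕ := Nat.size q.num.natAbs + Nat.size q.den + 1

/-- The number of bit operations charged for an arithmetic operation or a comparison. -/
def opCost (a b : ℚ) : ℕ := (bits a + bits b) ^ 2

def addQ (a b : ℚ) : Timed ℚ := ⟨a + b, opCost a b⟩

def mulQ (a b : ℚ) : Timed ℚ := ⟨a * b, opCost a b⟩

def ltQ (a b : ℚ) : Timed Bool := ⟨decide (a < b), opCost a b⟩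

def sumQ : List ℚ → Timed ℚ
  | [] => pure 0
  | a :: l => do
    let s ← sumQ l
    addQ a s

/-! ### Linear programs -/

/-- A linear program with rational data in the variables `x : Fin n → ℝ`: maximize `obj ⬝ x`
subject to `r.1 ⬝ x ≤ r.2` for all `r` in `rows` and to `0 ≤ x`. -/
structure LP where
  n : ℕ
  obj : Fin n → ℚ
  rows : List ((Fin n → ℚ) × ℚ)

/-- The feasible points of a linear program. -/
def LP.Feasible (L : LP) (x : Fin L.n → ℝ) : Prop :=
  (∀ k, 0 ≤ x k) ∧ ∀ r ∈ L.rows, ∑ k, (r.1 k : ℝ) * x k ≤ (r.2 : ℝ)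

/-- The values of a linear program at its feasible points. -/
def LP.values (L : LP) : Set ℝ := {t | ∃ x, L.Feasible x ∧ t = ∑ k, (L.obj k : ℝ) * x k}

/-- The encoding length of a linear program. -/
def LP.size (L : LP) : ℕ :=
  1 + L.n + ∑ k, bits (L.obj k) + (L.rows.map fun r => bits r.2 + ∑ k, bits (r.1 k)).sum

/-- An algorithm that determines the optimal value of every linear program that has a (rational)
optimal value; its running time includes the time for writing down the answer. -/
structure IsLPAlgorithm (alg : LP → Timed ℚ) : Prop where
  correct : ∀ (L : LP) (r : ℚ), IsGreatest L.values (r : ℝ) → (alg L).val = r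
  output_le : ∀ L : LP, bits (alg L).val ≤ (alg L).time

/-! ### The algorithm as a program that calls an LP algorithm -/

namespace Instance

/-- The input length of an instance. The number `p` enters in unary, since running times are to be
polynomial in `p` itself. -/
def size (I : Instance ℚ) : ℕ :=
  I.p + I.nA + I.nB + I.N +
    ∑ ξ, (I.nD ξ + ∑ j, Nat.size (I.passengers ξ j) +
      ∑ e, (1 + (I.requests ξ e).card + bits (I.value ξ e)))

variable (alg : LP → Timed ℚ) (I : Instance ℚ)

open Timed

/-- The LP constraint of request `j`. -/
def requestRow (ξ : Fin I.N) (j : Fin (I.nD ξ)) : Timed ((Fin (I.nE ξ) → ℚ) × ℚ) := do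
  let row ← table (β := fun _ => ℚ) fun e =>
    ⟨if j ∈ I.requests ξ e then 1 else 0, (I.requests ξ e).card + 1⟩
  pure (row, 1)

/-- The LP constraint of vehicle `i`; its right-hand side is zero for an augmented vehicle that is
not selected. -/
def vehicleRow (S : Finset (Fin I.nA)) (ξ : Fin I.N) (i : Fin I.nA ⊕ Fin I.nB) :
    Timed ((Fin (I.nE ξ) → ℚ) × ℚ) := do
  let row ← table (β := fun _ => ℚ) fun e => ⟨if I.vehicle ξ e = i then 1 else 0, 1⟩
  tick (S.card + 1)
  pure (row, if ∀ a, i = Sum.inl a → a ∈ S then 1 else 0)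

/-- Write down the assignment LP of scenario `ξ` for the selected set `S`. -/
def buildLP (S : Finset (Fin I.nA)) (ξ : Fin I.N) : Timed LP := do
  let obj ← table (β := fun _ => ℚ) fun e => ⟨I.value ξ e, bits (I.value ξ e)⟩
  let rD ← forList (I.requestRow ξ) (List.finRange (I.nD ξ))
  let rA ← forList (fun i => I.vehicleRow S ξ (Sum.inl i)) (List.finRange I.nA)
  let rB ← forList (fun i => I.vehicleRow S ξ (Sum.inr i)) (List.finRange I.nB)
  tick (rD.length + rA.length + rB.length)
  pure ⟨I.nE ξ, obj, rD ++ rA ++ rB⟩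

/-- Compute `v̂(S)` by solving one LP per scenario. -/
def vHatProg (S : Finset (Fin I.nA)) : Timed ℚ := do
  let vals ← forList (fun ξ => do
    let L ← I.buildLP S ξ
    alg L) (List.finRange I.N)
  let s ← sumQ vals
  mulQ (1 / (I.N : ℚ)) s

/-- All pairs of a vehicle in `S` and an augmented vehicle outside `S`. -/
def swapPairs (S : Finset (Fin I.nA)) : Timed (List (Fin I.nA × Fin I.nA)) :=
  let l := ((List.finRange I.nA).filter (· ∈ S)).product
    ((List.finRange I.nA).filter (· ∉ S))
  ⟨l, I.nA * (S.card + 1) + l.length⟩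

/-- The better one of a candidate and the best solution found before (if any). -/
def better (cand : Finset (Fin I.nA) × ℚ) :
    Option (Finset (Fin I.nA) × ℚ) → Timed (Option (Finset (Fin I.nA) × ℚ))
  | none => pure (some cand)
  | some best => do
    let b ← ltQ best.2 cand.2
    pure (some (if b then cand else best))

/-- Evaluate `v̂(S - i + i')` for all pairs in a list, and find the best one. -/
def bestSwap (S : Finset (Fin I.nA)) :
    List (Fin I.nA × Fin I.nA) → Timed (Option (Finset (Fin I.nA) × ℚ))
  | [] => pure none
  | q :: l => do
    let best ← bestSwap S l
    tick (S.card + 1)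
    let v ← I.vHatProg alg (I.swap S q.1 q.2)
    I.better (I.swap S q.1 q.2, v) best

/-- Accept the best swap if it improves the current value `cur` by a factor of more than `1 + ε`. -/
def accept (ε cur : ℚ) : Option (Finset (Fin I.nA) × ℚ) → Timed (Option (Finset (Fin I.nA)))
  | none => pure none
  | some best => do
    let thr ← mulQ (1 + ε) cur
    let b ← ltQ thr best.2
    pure (if b then some best.1 else none)

/-- The local swap subroutine: the new solution, or `none` if the local search halts. -/
def localSwap (ε : ℚ) (S : Finset (Fin I.nA)) : Timed (Option (Finset (Fin I.nA))) := do
  let cur ← I.vHatProg alg S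
  let pairs ← I.swapPairs S
  let best ← I.bestSwap alg S pairs
  I.accept ε cur best

/-- `LocalSearch alg I ε S S' t`: started from `S`, the local search halts with `S'` after `t`
steps. -/
inductive LocalSearch (ε : ℚ) : Finset (Fin I.nA) → Finset (Fin I.nA) → ℕ → Prop
  | halt {S : Finset (Fin I.nA)} {t : ℕ} :
      I.localSwap alg ε S = ⟨none, t⟩ → LocalSearch ε S S t
  | step {S S₁ S' : Finset (Fin I.nA)} {t t' : ℕ} :
      I.localSwap alg ε S = ⟨some S₁, t⟩ → LocalSearch ε S₁ S' t' →
        LocalSearch ε S S' (t + t')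

/-- The list of available trips. -/
def availableTrips (S : Finset (Fin I.nA)) (ξ : Fin I.N) : Timed (List (Fin (I.nE ξ))) :=
  ⟨(List.finRange (I.nE ξ)).filter (fun e => decide (I.Available S ξ e)),
    I.nE ξ * (S.card + 1)⟩

/-- Insert a trip into a list of trips with decreasing values. -/
def insertTrip (ξ : Fin I.N) (e : Fin (I.nE ξ)) : List (Fin (I.nE ξ)) →
    Timed (List (Fin (I.nE ξ)))
  | [] => do
    tick 1
    pure [e]
  | f :: l => do
    let b ← ltQ (I.value ξ e) (I.value ξ f)
    if b then do
      let l' ← insertTrip ξ e l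
      pure (f :: l')
    else pure (e :: f :: l)

/-- Sort trips by decreasing values. -/
def sortTrips (ξ : Fin I.N) : List (Fin (I.nE ξ)) → Timed (List (Fin (I.nE ξ)))
  | [] => pure []
  | e :: l => do
    let l' ← sortTrips ξ l
    I.insertTrip ξ e l'

/-- Test whether a trip is disjoint from all the trips in a list. -/
def disjointTest (ξ : Fin I.N) (e : Fin (I.nE ξ)) (c : List (Fin (I.nE ξ))) : Timed Bool :=
  ⟨decide (∀ f ∈ c, I.DisjointTrips ξ e f),
    1 + (c.map fun f => 1 + (I.requests ξ e).card * (I.requests ξ f).card).sum⟩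

/-- The greedy scan with its step count. -/
def scanProg (ξ : Fin I.N) : List (Fin (I.nE ξ)) → List (Fin (I.nE ξ)) →
    Timed (List (Fin (I.nE ξ)))
  | [], c => pure c
  | e :: l, c => do
    let b ← I.disjointTest ξ e c
    if b then scanProg ξ l (e :: c) else scanProg ξ l c

/-- The greedy algorithm in scenario `ξ`. -/
def greedyProg (S : Finset (Fin I.nA)) (ξ : Fin I.N) : Timed (Finset (Fin (I.nE ξ))) := do
  let l ← I.availableTrips S ξ
  let l' ← I.sortTrips ξ l
  let c ← I.scanProg ξ l' []
  pure c.toFinset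

/-- `Runs alg I ε S₀ S A t`: with the LP algorithm `alg` as a subroutine, the algorithm LSLPR started
from `S₀` halts after `t` steps, with the selected set `S` and the assignments `A`. -/
def Runs (ε : ℚ) (S₀ S : Finset (Fin I.nA)) (A : ∀ ξ, Finset (Fin (I.nE ξ))) (t : ℕ) : Prop :=
  ∃ t₁, LocalSearch alg I ε S₀ S t₁ ∧ A = (table fun ξ => I.greedyProg S ξ).val ∧
    t = I.K + t₁ + (table fun ξ => I.greedyProg S ξ).time

end Instance

end SRAMF

namespace SRAMF

namespace Instance

/-! ### Trip sizes, tolerance and swaps. -/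

section Common

variable {R : Type} [Zero R] [LE R] (I : Instance R)

/-! Let S be locally optimal, O another set of the same size, and x, y optimal fractional
assignments for them; V and V(O) are the LP values summed over the scenarios. If some vehicles T
switch to y while others keep x, it is enough to scale each trip of x by one minus the load that T
puts on its requests, truncated at 0 (`Feasible.exchange`). A trip has at most p - 1 requests, each
loaded at most once, so this costs a vehicle at most p - 1 times its value
(`Feasible.sum_conflict_le`).

Let m = |S \ O|. Each swap S - i + a with i in S \ O and a in O \ S is tested in two ways: only a
follows y, or a and all common vehicles (S ∩ O and the basis) do. Summed over all pairs with weights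
m - 1 and 1, the coefficients balance (`card_mul_le_of_exchange`) and give m V(O) ≤ (mp - (p - 1) +
m²ε) V. The slack p - 1 absorbs m²ε ≤ 1/p, so ε costs nothing in the ratio (`vHat_le_mul_vHat`). The
greedy rounding loses another factor p: every available trip meets a kept trip of at least its
value, and a kept trip meets fractional mass at most p (`IsGreedy.lpValue_le`).

For the iterations: after one swap the value is positive, hence at least v_min / N, and from then on
it grows geometrically below (n_A + n_B) v_max (`pow_mul_vmin_le`).

For the running time: positive rational values lie between 2^(-L) and 2^L, so pK²(3L + 1) swaps are
never exceeded (`no_long_chain`). Rational LPs have rational optimal values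
(`LP.exists_rat_eq_of_isGreatest`), so the guarantee of the LP algorithm applies, and its running
time bounds the length of the numbers it returns. -/

theorem card_requests_add_one_le (ξ : Fin I.N) (e : Fin (I.nE ξ)) :
    (I.requests ξ e).card + 1 ≤ I.p := by
  have h1 : (I.requests ξ e).card ≤ ∑ j ∈ I.requests ξ e, I.passengers ξ j := by
    rw [Finset.card_eq_sum_ones]
    exact Finset.sum_le_sum fun j _ => I.passengers_pos ξ j
  have h2 : I.cap (I.vehicle ξ e) ≤ Finset.univ.sup I.cap := Finset.le_sup (Finset.mem_univ _)
  have h3 := I.fits ξ e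
  unfold p
  omega

theorem p_pos : 0 < I.p := by
  unfold p
  omega

theorem two_le_p (ξ : Fin I.N) (e : Fin (I.nE ξ)) : 2 ≤ I.p := by
  have h1 := I.card_requests_add_one_le ξ e
  have h2 := (I.requests_nonempty ξ e).card_pos
  omega

theorem eps_pos : 0 < I.eps := by
  have h1 : (0 : ℚ) < I.p := by exact_mod_cast I.p_pos
  have h2 : (0 : ℚ) < I.K := by exact_mod_cast I.K_pos
  unfold eps
  positivity

theorem card_swap {S : Finset (Fin I.nA)} {i i' : Fin I.nA} (hi : i ∈ S) (hi' : i' ∉ S) :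
    (I.swap S i i').card = S.card := by
  unfold swap
  rw [Finset.card_insert_of_notMem (fun h => hi' (Finset.mem_of_mem_erase h)),
    Finset.card_erase_add_one hi]

theorem available_iff (S : Finset (Fin I.nA)) (ξ : Fin I.N) (e : Fin (I.nE ξ)) :
    I.Available S ξ e ↔ I.vehicle ξ e ∈ S.disjSum (Finset.univ : Finset (Fin I.nB)) := by
  unfold Available
  rcases I.vehicle ξ e with a | b <;> simp

end Common

/-! ### The assignment LP: attained optimum and monotonicity. -/

section Value

variable {I : Instance ℝ} {S S' : Finset (Fin I.nA)} {ξ : Fin I.N} {x y : Fin (I.nE ξ) → ℝ}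

theorem Feasible.le_one (h : I.Feasible S ξ x) (e : Fin (I.nE ξ)) : x e ≤ 1 :=
  (Finset.single_le_sum (f := x) (fun f _ => h.nonneg f) (by simp)).trans
    (h.vehicle_le (I.vehicle ξ e))

theorem feasible_zero : I.Feasible S ξ 0 := by
  constructor <;> simp

theorem Feasible.mono (hS : S ⊆ S') (h : I.Feasible S ξ x) : I.Feasible S' ξ x where
  nonneg := h.nonneg
  request_le := h.request_le
  vehicle_le := h.vehicle_le
  eq_zero e he := h.eq_zero e fun ha => he fun i hi => hS (ha i hi)

variable (I S ξ)

/-- The constraint of its own vehicle caps every coordinate at 1, so the feasible set is a closed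
part of a cube. Compactness makes the `sSup` in `lpValue` an attained maximum, which supplies the
optimal assignments that are exchanged later. -/
theorem isCompact_feasible : IsCompact {x | I.Feasible S ξ x} := by
  have hc : IsClosed {x | I.Feasible S ξ x} := by
    have : {x | I.Feasible S ξ x} =
        {x | ∀ e, 0 ≤ x e} ∩ {x | ∀ j, ∑ e with j ∈ I.requests ξ e, x e ≤ 1} ∩
        {x | ∀ i, ∑ e with I.vehicle ξ e = i, x e ≤ 1} ∩
        {x | ∀ e, ¬ I.Available S ξ e → x e = 0} := by
      ext x
      exact ⟨fun h => ⟨⟨⟨h.1, h.2⟩, h.3⟩, h.4⟩, fun h => ⟨h.1.1.1, h.1.1.2, h.1.2, h.2⟩⟩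
    rw [this]
    simp only [Set.ofPred_forall]
    refine ((IsClosed.inter ?_ ?_).inter ?_).inter ?_
    · exact isClosed_iInter fun e => isClosed_le continuous_const (continuous_apply e)
    · exact isClosed_iInter fun e => isClosed_le (by fun_prop) continuous_const
    · exact isClosed_iInter fun e => isClosed_le (by fun_prop) continuous_const
    · exact isClosed_iInter fun e => isClosed_iInter fun _ =>
        isClosed_eq (continuous_apply e) continuous_const
  refine (isCompact_Icc (a := (0 : Fin (I.nE ξ) → ℝ)) (b := 1)).of_isClosed_subset hc ?_
  exact fun x hx => ⟨hx.nonneg, hx.le_one⟩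

theorem isGreatest_lpValue :
    IsGreatest {t | ∃ x, I.Feasible S ξ x ∧ t = I.assignmentValue ξ x} (I.lpValue S ξ) := by
  have h : {t | ∃ x, I.Feasible S ξ x ∧ t = I.assignmentValue ξ x} =
      I.assignmentValue ξ '' {x | I.Feasible S ξ x} := by
    ext t
    simp [eq_comm]
  unfold lpValue
  rw [h]
  refine ((I.isCompact_feasible S ξ).image ?_).isGreatest_sSup ⟨_, 0, feasible_zero, rfl⟩
  unfold assignmentValue
  fun_prop

theorem exists_lpValue_eq : ∃ x, I.Feasible S ξ x ∧ I.lpValue S ξ = I.assignmentValue ξ x :=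
  (I.isGreatest_lpValue S ξ).1

variable {I S ξ}

theorem Feasible.le_lpValue (h : I.Feasible S ξ x) : I.assignmentValue ξ x ≤ I.lpValue S ξ :=
  (I.isGreatest_lpValue S ξ).2 ⟨x, h, rfl⟩

theorem lpValue_nonneg : 0 ≤ I.lpValue S ξ :=
  le_of_eq_of_le (by simp [assignmentValue]) (feasible_zero (S := S)).le_lpValue

theorem lpValue_mono (hS : S ⊆ S') : I.lpValue S ξ ≤ I.lpValue S' ξ := by
  obtain ⟨x, hx, h⟩ := I.exists_lpValue_eq S ξ
  rw [h]
  exact (hx.mono hS).le_lpValue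

theorem ipValue_le_lpValue : I.ipValue S ξ ≤ I.lpValue S ξ := by
  refine csSup_le ⟨0, 0, feasible_zero, by simp, by simp [assignmentValue]⟩ ?_
  rintro t ⟨x, hx, -, rfl⟩
  exact hx.le_lpValue

theorem vHat_nonneg : 0 ≤ I.vHat S :=
  mul_nonneg (by positivity) (Finset.sum_nonneg fun _ _ => lpValue_nonneg)

theorem vHat_mono (hS : S ⊆ S') : I.vHat S ≤ I.vHat S' :=
  mul_le_mul_of_nonneg_left (Finset.sum_le_sum fun _ _ => lpValue_mono hS) (by positivity)

theorem vStar_le_vHat : I.vStar S ≤ I.vHat S :=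
  mul_le_mul_of_nonneg_left (Finset.sum_le_sum fun _ _ => ipValue_le_lpValue) (by positivity)

end Value

/-! ### The exchange inequality -/

section Exchange

variable (I : Instance ℝ) (ξ : Fin I.N) (x y : Fin (I.nE ξ) → ℝ)

/-- The value that an assignment obtains from the trips of vehicle `i`. -/
def vehicleValue (i : Fin I.nA ⊕ Fin I.nB) : ℝ :=
  ∑ e, if I.vehicle ξ e = i then I.value ξ e * x e else 0

/-- The amount of request `j` that is served by vehicle `t`. -/
def load (t : Fin I.nA ⊕ Fin I.nB) (j : Fin (I.nD ξ)) : ℝ :=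
  ∑ e with j ∈ I.requests ξ e, if I.vehicle ξ e = t then y e else 0

/-- The loss of value at vehicle `i` of the assignment `x` when each of its trips is reduced
in proportion to the load of vehicle `t` in the assignment `y`. -/
def conflict (i t : Fin I.nA ⊕ Fin I.nB) : ℝ :=
  ∑ e, if I.vehicle ξ e = i then I.value ξ e * x e * ∑ j ∈ I.requests ξ e, I.load ξ y t j else 0

variable {I ξ x y} {S O U : Finset (Fin I.nA)}

theorem sum_vehicle_ite (T : Finset (Fin I.nA ⊕ Fin I.nB)) (s : Finset (Fin (I.nE ξ)))
    (w : Fin (I.nE ξ) → ℝ) :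
    ∑ t ∈ T, ∑ e ∈ s, (if I.vehicle ξ e = t then w e else 0) =
      ∑ e ∈ s, if I.vehicle ξ e ∈ T then w e else 0 := by
  rw [Finset.sum_comm]
  simp

theorem Feasible.assignmentValue_eq (hx : I.Feasible S ξ x) :
    I.assignmentValue ξ x =
      ∑ i ∈ S.disjSum (Finset.univ : Finset (Fin I.nB)), I.vehicleValue ξ x i := by
  unfold vehicleValue assignmentValue
  rw [sum_vehicle_ite]
  refine Finset.sum_congr rfl fun e _ => ?_
  split_ifs with h
  · rfl
  · rw [hx.eq_zero e (by rwa [available_iff]), mul_zero]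

theorem Feasible.sum_load_nonneg (hy : I.Feasible O ξ y) (T : Finset (Fin I.nA ⊕ Fin I.nB))
    (j : Fin (I.nD ξ)) : 0 ≤ ∑ t ∈ T, I.load ξ y t j := by
  refine Finset.sum_nonneg fun t _ => Finset.sum_nonneg fun e _ => ?_
  have := hy.nonneg e
  split_ifs <;> simp [this]

theorem Feasible.sum_load_le_one (hy : I.Feasible O ξ y) (T : Finset (Fin I.nA ⊕ Fin I.nB))
    (j : Fin (I.nD ξ)) : ∑ t ∈ T, I.load ξ y t j ≤ 1 := by
  unfold load
  rw [sum_vehicle_ite]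
  refine (Finset.sum_le_sum fun e _ => ?_).trans (hy.request_le j)
  have := hy.nonneg e
  split_ifs <;> simp [this]

theorem sum_conflict (T : Finset (Fin I.nA ⊕ Fin I.nB)) (i : Fin I.nA ⊕ Fin I.nB) :
    ∑ t ∈ T, I.conflict ξ x y i t = ∑ e, if I.vehicle ξ e = i then
      I.value ξ e * x e * ∑ j ∈ I.requests ξ e, ∑ t ∈ T, I.load ξ y t j else 0 := by
  unfold conflict
  rw [Finset.sum_comm]
  refine Finset.sum_congr rfl fun e _ => ?_
  split_ifs with h
  · rw [← Finset.mul_sum, Finset.sum_comm]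
  · simp

/-- A trip has at most p - 1 requests, and since `y` is feasible the vehicles of `T` together load
each of them at most once. -/
theorem Feasible.sum_conflict_le (hx : I.Feasible S ξ x) (hy : I.Feasible O ξ y)
    (T : Finset (Fin I.nA ⊕ Fin I.nB)) (i : Fin I.nA ⊕ Fin I.nB) :
    ∑ t ∈ T, I.conflict ξ x y i t ≤ ((I.p : ℝ) - 1) * I.vehicleValue ξ x i := by
  rw [sum_conflict, vehicleValue, Finset.mul_sum]
  refine Finset.sum_le_sum fun e _ => ?_
  split_ifs with h
  · rw [mul_comm]
    refine mul_le_mul_of_nonneg_right ?_ (mul_nonneg (I.value_nonneg ξ e) (hx.nonneg e))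
    have h1 : ∑ j ∈ I.requests ξ e, ∑ t ∈ T, I.load ξ y t j ≤ ((I.requests ξ e).card : ℝ) := by
      refine (Finset.sum_le_sum fun j _ => hy.sum_load_le_one T j).trans ?_
      simp
    have h2 : ((I.requests ξ e).card : ℝ) + 1 ≤ I.p := by
      exact_mod_cast I.card_requests_add_one_le ξ e
    linarith
  · simp

/-- Vehicles in `T` follow the assignment `y`, and vehicles in `R` follow the assignment `x`,
reduced so that the requests served by `T` remain covered at most once. -/
theorem Feasible.exchange (hx : I.Feasible S ξ x) (hy : I.Feasible O ξ y)
    {T R : Finset (Fin I.nA ⊕ Fin I.nB)} (hTR : Disjoint T R)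
    (hT : T ⊆ U.disjSum Finset.univ) (hR : R ⊆ U.disjSum Finset.univ) :
    ∑ t ∈ T, I.vehicleValue ξ y t +
      ∑ i ∈ R, (I.vehicleValue ξ x i - ∑ t ∈ T, I.conflict ξ x y i t) ≤ I.lpValue U ξ := by
  set l : Fin (I.nD ξ) → ℝ := fun j => ∑ t ∈ T, I.load ξ y t j with hl
  have l0 : ∀ j, 0 ≤ l j := hy.sum_load_nonneg T
  have l1 : ∀ j, l j ≤ 1 := hy.sum_load_le_one T
  -- The scaling factor of a trip of `x`; the truncation at 0 keeps the new assignment nonnegative.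
  set r : Fin (I.nE ξ) → ℝ := fun e => max 0 (1 - ∑ j ∈ I.requests ξ e, l j) with hr
  have r0 : ∀ e, 0 ≤ r e := fun e => le_max_left _ _
  have r1 : ∀ e, r e ≤ 1 := fun e =>
    max_le zero_le_one (by linarith [Finset.sum_nonneg fun j (_ : j ∈ I.requests ξ e) => l0 j])
  -- This is what makes requests feasible: `T` uses `l j` of request `j`, and the scaled trips of
  -- `x` use at most the remaining `1 - l j`.
  have rl : ∀ e, ∀ j ∈ I.requests ξ e, r e ≤ 1 - l j := fun e j hj =>
    max_le (by linarith [l1 j])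
      (by linarith [Finset.single_le_sum (f := l) (fun j _ => l0 j) hj])
  let z : Fin (I.nE ξ) → ℝ := fun e =>
    if I.vehicle ξ e ∈ T then y e else if I.vehicle ξ e ∈ R then x e * r e else 0
  have hz : I.Feasible U ξ z := by
    refine ⟨fun e => ?_, fun j => ?_, fun i => ?_, fun e he => ?_⟩
    · have h1 := hy.nonneg e
      have h2 := mul_nonneg (hx.nonneg e) (r0 e)
      simp only [z]
      split_ifs <;> simp [h1, h2]
    · have h1 : ∀ e ∈ Finset.univ.filter (fun e => j ∈ I.requests ξ e),
          z e ≤ (if I.vehicle ξ e ∈ T then y e else 0) + x e * (1 - l j) := by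
        intro e he
        have h3 := rl e j (by simpa using he)
        have h4 := mul_le_mul_of_nonneg_left h3 (hx.nonneg e)
        have h5 := mul_nonneg (hx.nonneg e) (r0 e)
        simp only [z]
        split_ifs <;> linarith
      refine (Finset.sum_le_sum h1).trans ?_
      rw [Finset.sum_add_distrib, ← Finset.sum_mul, ← sum_vehicle_ite]
      have h2 := mul_le_mul_of_nonneg_right (hx.request_le j) (sub_nonneg.2 (l1 j))
      change l j + _ ≤ 1
      linarith
    · by_cases hi : i ∈ T
      · refine (Finset.sum_le_sum fun e he => ?_).trans (hy.vehicle_le i)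
        have : I.vehicle ξ e = i := by simpa using he
        simp [z, this, hi]
      · refine (Finset.sum_le_sum fun e he => ?_).trans (hx.vehicle_le i)
        have : I.vehicle ξ e = i := by simpa using he
        simp only [z, this, hi, if_false]
        split_ifs
        · exact mul_le_of_le_one_right (hx.nonneg e) (r1 e)
        · exact hx.nonneg e
    · rw [available_iff] at he
      simp only [z, if_neg fun h => he (hT h), if_neg fun h => he (hR h)]
  refine le_trans ?_ hz.le_lpValue
  simp only [sum_conflict, vehicleValue, ← Finset.sum_sub_distrib]
  have h1 : ∀ i e, ((if I.vehicle ξ e = i then I.value ξ e * x e else 0) -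
      if I.vehicle ξ e = i then I.value ξ e * x e * ∑ j ∈ I.requests ξ e, l j else 0) =
      if I.vehicle ξ e = i then I.value ξ e * x e * (1 - ∑ j ∈ I.requests ξ e, l j) else 0 := by
    intro i e
    split_ifs <;> ring
  simp only [hl] at h1
  simp only [h1, sum_vehicle_ite, ← Finset.sum_add_distrib]
  refine Finset.sum_le_sum fun e _ => ?_
  -- The truncation can only raise the value above the linear expression with the conflicts.
  have h2 := mul_le_mul_of_nonneg_left (le_max_right 0 (1 - ∑ j ∈ I.requests ξ e, l j))
    (mul_nonneg (I.value_nonneg ξ e) (hx.nonneg e))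
  simp only [z, hr]
  by_cases hT' : I.vehicle ξ e ∈ T
  · simp [hT', Finset.disjoint_left.1 hTR hT']
  · by_cases hR' : I.vehicle ξ e ∈ R
    · simp only [hT', hR', if_true, if_false, zero_add]
      linarith
    · simp [hT', hR']

end Exchange

end Instance

/-- Each element is missing from exactly one of the sets `P.erase i`. -/
theorem sum_sum_erase {α : Type*} [DecidableEq α] (P : Finset α) (g : α → ℝ) :
    ∑ i ∈ P, ∑ r ∈ P.erase i, g r = ((P.card : ℝ) - 1) * ∑ r ∈ P, g r := by
  have h : ∀ i ∈ P, ∑ r ∈ P.erase i, g r = ∑ r ∈ P, g r - g i := fun i hi => by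
    rw [← Finset.add_sum_erase P g hi]
    ring
  rw [Finset.sum_congr rfl h, Finset.sum_sub_distrib, Finset.sum_const, nsmul_eq_mul]
  ring

/-- Summation of the exchange inequalities over all pairs of a vehicle of `P` and a vehicle
of `D`. -/
theorem card_mul_le_of_exchange {α : Type*} [DecidableEq α] {P D C : Finset α}
    (hcard : D.card = P.card) (hP : P.Nonempty) {X Y : α → ℝ} {c : α → α → ℝ} {B κ : ℝ}
    (h1 : ∀ i ∈ P, ∀ a ∈ D,
      Y a + (∑ r ∈ C, (X r - c r a) + ∑ r ∈ P.erase i, (X r - c r a)) ≤ B)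
    (h2 : ∀ i ∈ P, ∀ a ∈ D,
      ∑ t ∈ C, Y t + Y a + ∑ r ∈ P.erase i, (X r - (∑ t ∈ C, c r t + c r a)) ≤ B)
    (hcP : ∀ r ∈ P, ∑ t ∈ C, c r t + ∑ t ∈ D, c r t ≤ κ * X r)
    (hcC : ∀ r ∈ C, ∑ t ∈ D, c r t ≤ κ * X r) :
    (P.card : ℝ) * (∑ t ∈ C, Y t + ∑ t ∈ D, Y t) +
      ((P.card : ℝ) - 1) * (P.card - κ) * (∑ r ∈ C, X r + ∑ r ∈ P, X r) ≤
      (P.card : ℝ) ^ 2 * B := by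
  have hm : (1 : ℝ) ≤ P.card := by exact_mod_cast hP.card_pos
  set m : ℝ := (P.card : ℝ) with hmdef
  have hD : (D.card : ℝ) = m := by rw [hcard]
  have e1 := Finset.sum_le_sum fun i hi => Finset.sum_le_sum fun a ha => h1 i hi a ha
  have e2 := Finset.sum_le_sum fun i hi => Finset.sum_le_sum fun a ha => h2 i hi a ha
  have e3 := Finset.sum_le_sum hcP
  have e4 := Finset.sum_le_sum hcC
  have hcomm : ∀ g : α → α → ℝ, ∑ i ∈ P, ∑ a ∈ D, ∑ r ∈ P.erase i, g a r =
      (m - 1) * ∑ a ∈ D, ∑ r ∈ P, g a r := by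
    intro g
    rw [Finset.sum_comm, Finset.mul_sum]
    exact Finset.sum_congr rfl fun a _ => sum_sum_erase P (g a)
  have hPD : ∑ a ∈ D, ∑ r ∈ P, c r a = ∑ r ∈ P, ∑ a ∈ D, c r a := Finset.sum_comm
  have hCD : ∑ a ∈ D, ∑ r ∈ C, c r a = ∑ r ∈ C, ∑ a ∈ D, c r a := Finset.sum_comm
  simp only [Finset.sum_add_distrib, hcomm] at e1 e2
  simp only [Finset.sum_add_distrib, Finset.sum_sub_distrib, Finset.sum_const, nsmul_eq_mul, hD,
    ← hmdef, hPD, hCD, ← Finset.mul_sum] at e1 e2 e3 e4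
  -- With weight `m - 1` on `e1` and 1 on `e2`, every `Y` gets the coefficient `m ^ 2`, every `X`
  -- gets `m ^ 2 * (m - 1)`, and all three groups of conflicts (`P` with `C`, `P` with `D`, `C` with
  -- `D`) get `m * (m - 1)`. Hence the conflicts are bounded by `e3` and `e4` together.
  have e5 := mul_le_mul_of_nonneg_left e1 (sub_nonneg.2 hm)
  have e6 := mul_le_mul_of_nonneg_left (add_le_add e3 e4) (sub_nonneg.2 hm)
  -- The weighted sum is the claim multiplied by `m`.
  refine le_of_mul_le_mul_left (a := m) ?_ (by linarith)
  have e7 := mul_le_mul_of_nonneg_left e6 (by linarith : (0 : ℝ) ≤ m)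
  linarith [e2, e5, e7]

namespace Instance

/-! ### Local optima of the LP value. -/

section Ratio

variable {I : Instance ℝ} {S O : Finset (Fin I.nA)}

/-- Every trip carries at least one passenger, so there are no trips when all capacities vanish. -/
theorem vHat_eq_zero_of_p_eq_one (hp : I.p = 1) : I.vHat S = 0 := by
  unfold vHat
  rw [Finset.sum_eq_zero, mul_zero]
  intro ξ _
  obtain ⟨x, -, h⟩ := I.exists_lpValue_eq S ξ
  rw [h]
  refine Finset.sum_eq_zero fun e _ => ?_
  have := I.two_le_p ξ e
  omega

/-- A solution without improving swaps is within a factor `p` of every solution of the same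
cardinality. -/
theorem vHat_le_mul_vHat (hS : S.card = I.K) (hO : O.card = I.K)
    (halted : ∀ S', ¬ I.ImprovingSwap (I.eps : ℝ) S S') : I.vHat O ≤ (I.p : ℝ) * I.vHat S := by
  -- The case `p = 1` is separate because absorbing the tolerance needs `1 / p ≤ p - 1`.
  rcases (Nat.succ_le_of_lt I.p_pos).eq_or_lt with hp | hp
  · simp [vHat_eq_zero_of_p_eq_one hp.symm]
  have hp2 : (2 : ℝ) ≤ I.p := by exact_mod_cast hp
  have hN : (0 : ℝ) < 1 / (I.N : ℝ) := one_div_pos.2 (by exact_mod_cast I.N_pos)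
  choose x hx hxv using I.exists_lpValue_eq S
  choose y hy hyv using I.exists_lpValue_eq O
  have hV : 0 ≤ ∑ ξ, I.lpValue S ξ := Finset.sum_nonneg fun _ _ => lpValue_nonneg
  suffices h : ∑ ξ, I.lpValue O ξ ≤ I.p * ∑ ξ, I.lpValue S ξ by
    unfold vHat
    have := mul_le_mul_of_nonneg_left h hN.le
    linarith
  have hcard : (O \ S).card = (S \ O).card := by
    have h1 := Finset.card_sdiff_add_card_inter O S
    have h2 := Finset.card_sdiff_add_card_inter S O
    rw [Finset.inter_comm] at h2
    omega
  rcases (S \ O).eq_empty_or_nonempty with hP | hP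
  · have h1 : S = O := Finset.eq_of_subset_of_card_le (Finset.sdiff_eq_empty_iff_subset.1 hP)
      (by omega)
    rw [← h1]
    nlinarith
  have hswap : ∀ i ∈ S \ O, ∀ a ∈ O \ S,
      ∑ ξ, I.lpValue (I.swap S i a) ξ ≤ (1 + (I.eps : ℝ)) * ∑ ξ, I.lpValue S ξ := by
    intro i hi a ha
    rw [Finset.mem_sdiff] at hi ha
    have h1 := halted (I.swap S i a)
    simp only [ImprovingSwap, not_exists, not_and, not_lt] at h1
    have h2 := h1 i hi.1 a ha.2 rfl
    unfold vHat at h2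
    refine le_of_mul_le_mul_left (a := 1 / (I.N : ℝ)) ?_ hN
    linarith
  -- `P` holds the vehicles that may leave, `D` those that may enter, and `C` those present on both
  -- sides, including every basis vehicle.
  let P := (S \ O).disjSum (∅ : Finset (Fin I.nB))
  let D := (O \ S).disjSum (∅ : Finset (Fin I.nB))
  let C := (S ∩ O).disjSum (Finset.univ : Finset (Fin I.nB))
  have hCP : Disjoint C P := by
    rw [Finset.disjoint_left]
    rintro (a | b) <;> simp [C, P]
    tauto
  have hCD : Disjoint C D := by
    rw [Finset.disjoint_left]
    rintro (a | b) <;> simp [C, D]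
    tauto
  have hSCP : S.disjSum Finset.univ = C ∪ P := by
    ext (a | b) <;> simp [C, P]
    tauto
  have hOCD : O.disjSum Finset.univ = C ∪ D := by
    ext (a | b) <;> simp [C, D]
    tauto
  let X := fun i => ∑ ξ, I.vehicleValue ξ (x ξ) i
  let Y := fun i => ∑ ξ, I.vehicleValue ξ (y ξ) i
  let c := fun i t => ∑ ξ, I.conflict ξ (x ξ) (y ξ) i t
  have hX : ∑ ξ, I.lpValue S ξ = ∑ r ∈ C, X r + ∑ r ∈ P, X r := by
    rw [← Finset.sum_union hCP, ← hSCP, Finset.sum_comm]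
    exact Finset.sum_congr rfl fun ξ _ => by rw [hxv, (hx ξ).assignmentValue_eq]
  have hY : ∑ ξ, I.lpValue O ξ = ∑ r ∈ C, Y r + ∑ r ∈ D, Y r := by
    rw [← Finset.sum_union hCD, ← hOCD, Finset.sum_comm]
    exact Finset.sum_congr rfl fun ξ _ => by rw [hyv, (hy ξ).assignmentValue_eq]
  have hc : ∀ T r, ∑ t ∈ T, c r t ≤ ((I.p : ℝ) - 1) * X r := by
    intro T r
    simp only [c, X]
    rw [Finset.sum_comm, Finset.mul_sum]
    exact Finset.sum_le_sum fun ξ _ => (hx ξ).sum_conflict_le (hy ξ) T r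
  have hexch : ∀ T R : Finset (Fin I.nA ⊕ Fin I.nB), ∀ i ∈ S \ O, ∀ a ∈ O \ S, Disjoint T R →
      T ⊆ (I.swap S i a).disjSum Finset.univ → R ⊆ (I.swap S i a).disjSum Finset.univ →
      ∑ t ∈ T, Y t + ∑ r ∈ R, (X r - ∑ t ∈ T, c r t) ≤
        (1 + (I.eps : ℝ)) * ∑ ξ, I.lpValue S ξ := by
    intro T R i hi a ha hTR hT hR
    refine le_trans (le_of_eq ?_) ((Finset.sum_le_sum fun ξ (_ : ξ ∈ Finset.univ) =>
      (hx ξ).exchange (hy ξ) hTR hT hR).trans (hswap i hi a ha))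
    rw [Finset.sum_add_distrib, Finset.sum_comm (s := T), Finset.sum_comm (t := R)]
    congr 1
    refine Finset.sum_congr rfl fun r _ => ?_
    rw [Finset.sum_sub_distrib, Finset.sum_comm (t := T)]
  have key := card_mul_le_of_exchange (P := P) (D := D) (C := C) (X := X) (Y := Y) (c := c)
    (B := (1 + (I.eps : ℝ)) * ∑ ξ, I.lpValue S ξ) (κ := (I.p : ℝ) - 1) (by simpa [P, D] using hcard)
    ⟨Sum.inl hP.choose, by simpa [P] using hP.choose_spec⟩ ?_ ?_ ?_ ?_
  · rw [← hX, ← hY] at key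
    have hPc : P.card = (S \ O).card := by simp [P]
    have hm1 : (1 : ℝ) ≤ P.card := by
      rw [hPc]
      exact_mod_cast hP.card_pos
    have hmK : (P.card : ℝ) ≤ I.K := by
      rw [hPc, ← hS]
      exact_mod_cast Finset.card_le_card Finset.sdiff_subset
    set m : ℝ := (P.card : ℝ)
    have hK : (1 : ℝ) ≤ I.K := by exact_mod_cast I.K_pos
    -- Since `κ = p - 1`, `key` says that `m` times the value of `O` is at most `m * p - (p - 1) + m
    -- ^ 2 * ε` times that of `S`. From `m ≤ K` comes `m ^ 2 * ε ≤ 1 / p ≤ p - 1`, which the slack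
    -- covers.
    have heps : m ^ 2 * (I.eps : ℝ) ≤ (I.p : ℝ) - 1 := by
      have h1 : (I.eps : ℝ) = 1 / ((I.p : ℝ) * (I.K : ℝ) ^ 2) := by simp [eps]
      rw [h1, mul_one_div, div_le_iff₀ (by positivity)]
      have h2 : m ^ 2 ≤ (I.K : ℝ) ^ 2 := by gcongr
      have h3 : 1 ≤ ((I.p : ℝ) - 1) * I.p := by nlinarith
      have h4 : 0 ≤ (I.K : ℝ) ^ 2 := by positivity
      nlinarith
    have h5 := mul_le_mul_of_nonneg_right heps hV
    refine le_of_mul_le_mul_left (a := m) ?_ (by linarith)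
    linarith
  · rintro (i | b) hi (a | b') ha
    · simp only [P, D, Finset.inl_mem_disjSum] at hi ha
      -- First test of the swap: only the new vehicle follows `y`, all remaining ones keep `x`.
      have h := hexch {Sum.inl a} (C ∪ P.erase (Sum.inl i)) i hi a ha ?_ ?_ ?_
      · rw [Finset.sum_union (hCP.mono_right (Finset.erase_subset _ _))] at h
        simpa using h
      · simp only [Finset.mem_sdiff] at ha
        simp [C, P, ha]
      · simp [swap]
      · rintro (r | b) hr
        · simp only [Finset.mem_sdiff] at ha hi
          simp [C, P] at hr
          simp only [swap, Finset.inl_mem_disjSum, Finset.mem_insert, Finset.mem_erase]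
          rcases hr with hr | hr
          · refine Or.inr ⟨?_, hr.1⟩
            rintro rfl
            exact hi.2 hr.2
          · exact Or.inr ⟨hr.1, hr.2.1⟩
        · simp
    all_goals simp [P, D] at hi ha
  · rintro (i | b) hi (a | b') ha
    · simp only [P, D, Finset.inl_mem_disjSum] at hi ha
      have haC : Sum.inl a ∉ C := by
        simp only [Finset.mem_sdiff] at ha
        simp [C, ha]
      -- Second test: the common vehicles follow `y` as well, and only the rest of `P` keeps `x`.
      have h := hexch (insert (Sum.inl a) C) (P.erase (Sum.inl i)) i hi a ha ?_ ?_ ?_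
      · simp only [Finset.sum_insert haC] at h
        simp only [add_comm (∑ t ∈ C, _)]
        exact h
      · rw [Finset.disjoint_insert_left]
        simp only [Finset.mem_sdiff] at ha
        exact ⟨by simp [P, ha], hCP.mono_right (Finset.erase_subset _ _)⟩
      · rintro (r | b) hr
        · simp only [Finset.mem_sdiff] at ha hi
          simp [C] at hr
          simp only [swap, Finset.inl_mem_disjSum, Finset.mem_insert, Finset.mem_erase]
          rcases hr with hr | hr
          · exact Or.inl hr
          · refine Or.inr ⟨?_, hr.1⟩
            rintro rfl
            exact hi.2 hr.2
        · simp
      · rintro (r | b) hr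
        · simp [P] at hr
          simp [swap, hr]
        · simp
    all_goals simp [P, D] at hi ha
  · intro r _
    rw [← Finset.sum_union hCD]
    exact hc _ r
  · exact fun r _ => hc _ r

end Ratio

/-! ### The greedy algorithm -/

section Greedy

variable {R : Type} [Zero R] [LE R] {I : Instance R} {ξ : Fin I.N}

theorem DisjointTrips.symm {e f : Fin (I.nE ξ)} (h : I.DisjointTrips ξ e f) :
    I.DisjointTrips ξ f e :=
  ⟨h.1.symm, h.2.symm⟩

theorem mem_greedyScan_of_mem (l : List (Fin (I.nE ξ))) {c : List (Fin (I.nE ξ))}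
    {e : Fin (I.nE ξ)} (he : e ∈ c) : e ∈ I.greedyScan ξ l c := by
  induction l generalizing c with
  | nil => exact he
  | cons f l ih =>
    unfold greedyScan
    split_ifs
    · exact ih (List.mem_cons_of_mem _ he)
    · exact ih he

theorem mem_or_mem_of_mem_greedyScan {l c : List (Fin (I.nE ξ))}
    {e : Fin (I.nE ξ)} (he : e ∈ I.greedyScan ξ l c) : e ∈ l ∨ e ∈ c := by
  induction l generalizing c with
  | nil => exact Or.inr he
  | cons f l ih =>
    unfold greedyScan at he
    split_ifs at he
    · have := ih he
      simp only [List.mem_cons] at this ⊢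
      tauto
    · have := ih he
      simp only [List.mem_cons] at this ⊢
      tauto

theorem pairwise_greedyScan (l : List (Fin (I.nE ξ))) {c : List (Fin (I.nE ξ))}
    (hc : c.Pairwise (I.DisjointTrips ξ)) :
    (I.greedyScan ξ l c).Pairwise (I.DisjointTrips ξ) := by
  induction l generalizing c with
  | nil => exact hc
  | cons f l ih =>
    unfold greedyScan
    split_ifs with h
    · exact ih (List.pairwise_cons.2 ⟨h, hc⟩)
    · exact ih hc

theorem disjointTrips_of_mem_greedyScan {l : List (Fin (I.nE ξ))} {e f : Fin (I.nE ξ)}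
    (he : e ∈ I.greedyScan ξ l []) (hf : f ∈ I.greedyScan ξ l []) (hef : e ≠ f) :
    I.DisjointTrips ξ e f :=
  haveI : Std.Symm (I.DisjointTrips ξ) := ⟨fun _ _ h => h.symm⟩
  (pairwise_greedyScan l List.Pairwise.nil).forall he hf hef

/-- Every scanned trip meets a kept trip that is at least as valuable. -/
theorem exists_mem_greedyScan {l c : List (Fin (I.nE ξ))} {le : Fin (I.nE ξ) → Fin (I.nE ξ) → Prop}
    (hrefl : ∀ e, le e e) (hl : l.Pairwise (fun e f => le f e))
    (hc : ∀ f ∈ c, ∀ e ∈ l, le e f) {e : Fin (I.nE ξ)} (he : e ∈ l) :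
    ∃ f ∈ I.greedyScan ξ l c, le e f ∧ ¬ I.DisjointTrips ξ e f := by
  -- The hypothesis `hc` is the invariant of the scan: kept trips dominate all trips still to come.
  -- The order of the list preserves it when a trip is kept.
  induction l generalizing c with
  | nil => simp at he
  | cons g l ih =>
    rw [List.pairwise_cons] at hl
    unfold greedyScan
    split_ifs with h
    · rcases List.mem_cons.1 he with rfl | he
      -- A kept trip is its own witness, as it shares its vehicle with itself.
      · exact ⟨e, mem_greedyScan_of_mem l (List.mem_cons_self ..), hrefl e, fun hd => hd.1 rfl⟩
      · refine ih hl.2 (fun f hf e' he' => ?_) he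
        rcases List.mem_cons.1 hf with rfl | hf
        · exact hl.1 e' he'
        · exact hc f hf e' (List.mem_cons_of_mem _ he')
    · rcases List.mem_cons.1 he with rfl | he
      · push Not at h
        obtain ⟨f, hf, hd⟩ := h
        exact ⟨f, mem_greedyScan_of_mem l hf, hc f hf e (List.mem_cons_self ..), hd⟩
      · exact ih hl.2 (fun f hf e' he' => hc f hf e' (List.mem_cons_of_mem _ he')) he

end Greedy

/-! ### Greedy against the LP, and the combined ratio. -/

section GreedyRatio

variable {I : Instance ℝ} {S : Finset (Fin I.nA)} {ξ : Fin I.N} {A : Finset (Fin (I.nE ξ))}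

theorem IsGreedy.disjointTrips (hA : I.IsGreedy S ξ A) {e f : Fin (I.nE ξ)} (he : e ∈ A)
    (hf : f ∈ A) (hef : e ≠ f) : I.DisjointTrips ξ e f := by
  obtain ⟨l, -, -, -, rfl⟩ := hA
  exact disjointTrips_of_mem_greedyScan (by simpa using he) (by simpa using hf) hef

theorem IsGreedy.available (hA : I.IsGreedy S ξ A) {e : Fin (I.nE ξ)} (he : e ∈ A) :
    I.Available S ξ e := by
  obtain ⟨l, -, hl, -, rfl⟩ := hA
  have := mem_or_mem_of_mem_greedyScan (by simpa using he)
  simpa [hl] using this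

theorem IsGreedy.exists_meets (hA : I.IsGreedy S ξ A) {e : Fin (I.nE ξ)}
    (he : I.Available S ξ e) :
    ∃ f ∈ A, I.value ξ e ≤ I.value ξ f ∧ ¬ I.DisjointTrips ξ e f := by
  obtain ⟨l, -, hl, hs, rfl⟩ := hA
  simpa using exists_mem_greedyScan (le := fun e f => I.value ξ e ≤ I.value ξ f) (c := [])
    (fun _ => le_rfl) hs (by simp) ((hl e).2 he)

theorem sum_indicator_le_one {s A : Finset (Fin (I.nE ξ))}
    (h : ∀ e ∈ s, ∀ f ∈ s, e ∈ A → f ∈ A → e = f) : ∑ e ∈ s, I.indicator ξ A e ≤ 1 := by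
  unfold indicator
  rw [← Finset.sum_filter, Finset.sum_const, nsmul_eq_mul, mul_one]
  refine Nat.cast_le_one.2 (Finset.card_le_one.2 fun e he f hf => ?_)
  rw [Finset.mem_filter] at he hf
  exact h e he.1 f hf.1 he.2 hf.2

theorem IsGreedy.feasible (hA : I.IsGreedy S ξ A) : I.Feasible S ξ (I.indicator ξ A) where
  nonneg e := by
    unfold indicator
    split_ifs <;> simp
  request_le j := by
    refine sum_indicator_le_one fun e he f hf heA hfA => ?_
    by_contra hef
    exact Finset.disjoint_left.1 (hA.disjointTrips heA hfA hef).2 (by simpa using he)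
      (by simpa using hf)
  vehicle_le i := by
    refine sum_indicator_le_one fun e he f hf heA hfA => ?_
    by_contra hef
    refine (hA.disjointTrips heA hfA hef).1 ?_
    simp only [Finset.mem_filter_univ] at he hf
    rw [he, hf]
  eq_zero e he := if_neg fun h => he (hA.available h)

/-- A trip meeting `f` shares its vehicle or one of its at most p - 1 requests, and `x` uses each of
these at most once. -/
theorem Feasible.sum_meets_le {x : Fin (I.nE ξ) → ℝ} (hx : I.Feasible S ξ x)
    (f : Fin (I.nE ξ)) : ∑ e with ¬ I.DisjointTrips ξ e f, x e ≤ I.p := by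
  classical
  have h1 : Finset.univ.filter (fun e => ¬ I.DisjointTrips ξ e f) ⊆
      Finset.univ.filter (fun e => I.vehicle ξ e = I.vehicle ξ f) ∪
        (I.requests ξ f).biUnion fun j => Finset.univ.filter (fun e => j ∈ I.requests ξ e) := by
    intro e he
    simp only [Finset.mem_filter_univ, DisjointTrips, not_and_or, not_not,
      Finset.not_disjoint_iff] at he
    simp only [Finset.mem_union, Finset.mem_filter_univ, Finset.mem_biUnion]
    rcases he with he | ⟨j, hj, hj'⟩
    · exact Or.inl he
    · exact Or.inr ⟨j, hj', hj⟩
  have h2 := Finset.sum_le_sum_of_subset_of_nonneg h1 (f := x) fun e _ _ => hx.nonneg e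
  have h3 : ∀ s t : Finset (Fin (I.nE ξ)), ∑ e ∈ s ∪ t, x e ≤ ∑ e ∈ s, x e + ∑ e ∈ t, x e := by
    intro s t
    rw [← Finset.sum_union_inter]
    linarith [Finset.sum_nonneg fun e (_ : e ∈ s ∩ t) => hx.nonneg e]
  have h4 : ∀ J : Finset (Fin (I.nD ξ)),
      ∑ e ∈ J.biUnion fun j => Finset.univ.filter (fun e => j ∈ I.requests ξ e), x e ≤ J.card := by
    intro J
    induction J using Finset.induction_on with
    | empty => simp
    | insert j J hj ih =>
      rw [Finset.biUnion_insert, Finset.card_insert_of_notMem hj]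
      push_cast
      linarith [h3 (Finset.univ.filter (fun e => j ∈ I.requests ξ e))
        (J.biUnion fun j => Finset.univ.filter (fun e => j ∈ I.requests ξ e)), hx.request_le j]
  have h5 : ((I.requests ξ f).card : ℝ) + 1 ≤ I.p := by
    exact_mod_cast I.card_requests_add_one_le ξ f
  linarith [h3 (Finset.univ.filter (fun e => I.vehicle ξ e = I.vehicle ξ f))
    ((I.requests ξ f).biUnion fun j => Finset.univ.filter (fun e => j ∈ I.requests ξ e)),
    hx.vehicle_le (I.vehicle ξ f), h4 (I.requests ξ f)]

/-- Charging: the fractional value of an available trip is charged to a kept trip that it meets and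
that is worth at least as much. By `Feasible.sum_meets_le`, a kept trip is charged at most p times
its value. -/
theorem IsGreedy.lpValue_le (hA : I.IsGreedy S ξ A) :
    I.lpValue S ξ ≤ I.p * I.assignmentValue ξ (I.indicator ξ A) := by
  obtain ⟨x, hx, hv⟩ := I.exists_lpValue_eq S ξ
  have h1 : I.assignmentValue ξ (I.indicator ξ A) = ∑ f ∈ A, I.value ξ f := by
    simp [assignmentValue, indicator]
  rw [hv, h1, Finset.mul_sum]
  calc I.assignmentValue ξ x
      ≤ ∑ e, ∑ f ∈ A, if ¬ I.DisjointTrips ξ e f then I.value ξ f * x e else 0 := by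
        refine Finset.sum_le_sum fun e _ => ?_
        have h0 : ∀ f ∈ A, 0 ≤ if ¬ I.DisjointTrips ξ e f then I.value ξ f * x e else 0 := by
          intro f _
          have := mul_nonneg (I.value_nonneg ξ f) (hx.nonneg e)
          split_ifs <;> simp [this]
        by_cases he : I.Available S ξ e
        · obtain ⟨f, hf, hle, hd⟩ := hA.exists_meets he
          refine le_trans ?_ (Finset.single_le_sum h0 hf)
          rw [if_pos hd]
          exact mul_le_mul_of_nonneg_right hle (hx.nonneg e)
        · rw [hx.eq_zero e he, mul_zero]
          simp
    _ = ∑ f ∈ A, I.value ξ f * ∑ e with ¬ I.DisjointTrips ξ e f, x e := by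
        rw [Finset.sum_comm]
        refine Finset.sum_congr rfl fun f _ => ?_
        rw [Finset.sum_filter, Finset.mul_sum]
        refine Finset.sum_congr rfl fun e _ => ?_
        split_ifs <;> simp
    _ ≤ ∑ f ∈ A, I.p * I.value ξ f := by
        refine Finset.sum_le_sum fun f _ => ?_
        rw [mul_comm (I.p : ℝ)]
        exact mul_le_mul_of_nonneg_left (hx.sum_meets_le f) (I.value_nonneg ξ f)

theorem ImprovingSwap.card_eq {ε : ℝ} {S' : Finset (Fin I.nA)} (h : I.ImprovingSwap ε S S') :
    S'.card = S.card := by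
  obtain ⟨i, hi, i', hi', rfl, -⟩ := h
  exact I.card_swap hi hi'

theorem card_eq_of_path {ε : ℝ} {S₀ : Finset (Fin I.nA)}
    (h : Relation.ReflTransGen (I.ImprovingSwap ε) S₀ S) : S.card = S₀.card := by
  induction h with
  | refl => rfl
  | tail _ h ih => rw [h.card_eq, ih]

theorem IsOutput.ratio {S₀ : Finset (Fin I.nA)} {A : ∀ ξ, Finset (Fin (I.nE ξ))}
    (h : I.IsOutput (I.eps : ℝ) S₀ S A) (S' : Finset (Fin I.nA)) (hS' : S'.card ≤ I.K) :
    1 / (I.p : ℝ) * I.vHat S' ≤ I.vHat S ∧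
      1 / (I.p : ℝ) ^ 2 * I.vStar S' ≤ I.outputValue A := by
  have hp : (0 : ℝ) < I.p := by exact_mod_cast I.p_pos
  have hcard : S.card = I.K := (card_eq_of_path h.path).trans h.card_start
  -- The swap argument compares sets of equal size, so `S'` is first enlarged to size `K`;
  -- monotonicity allows this.
  obtain ⟨O, hO, hOc⟩ := Finset.exists_superset_card_eq hS' (by simpa using I.K_le)
  have h1 : I.vHat S' ≤ I.p * I.vHat S :=
    (vHat_mono hO).trans (vHat_le_mul_vHat hcard hOc h.halted)
  have h2 : I.vHat S ≤ I.p * I.outputValue A := by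
    unfold vHat outputValue
    rw [mul_left_comm, Finset.mul_sum (a := (I.p : ℝ))]
    exact mul_le_mul_of_nonneg_left (Finset.sum_le_sum fun ξ _ => (h.greedy ξ).lpValue_le)
      (by positivity)
  have h3 := vStar_le_vHat (S := S')
  constructor
  · rw [one_div, inv_mul_le_iff₀ hp]
    exact h1
  · rw [one_div, inv_mul_le_iff₀ (by positivity)]
    nlinarith

end GreedyRatio

/-! ### The number of swaps -/

section Iterations

variable {I : Instance ℝ} {S : Finset (Fin I.nA)}

/-- Grouping trips by vehicle, the total mass of `x` is at most the number of vehicles. -/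
theorem lpValue_le_mul {vmax : ℝ} (hmax : ∀ ξ e, I.value ξ e ≤ vmax) (h0 : 0 ≤ vmax)
    (ξ : Fin I.N) : I.lpValue S ξ ≤ ((I.nA : ℝ) + I.nB) * vmax := by
  obtain ⟨x, hx, hv⟩ := I.exists_lpValue_eq S ξ
  rw [hv]
  have h1 : ∑ e, x e ≤ (I.nA : ℝ) + I.nB := by
    calc ∑ e, x e = ∑ i, ∑ e with I.vehicle ξ e = i, x e := by
          rw [Finset.sum_fiberwise]
      _ ≤ ∑ i : Fin I.nA ⊕ Fin I.nB, 1 := Finset.sum_le_sum fun i _ => hx.vehicle_le i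
      _ = (I.nA : ℝ) + I.nB := by simp
  calc I.assignmentValue ξ x ≤ ∑ e, vmax * x e :=
        Finset.sum_le_sum fun e _ => mul_le_mul_of_nonneg_right (hmax ξ e) (hx.nonneg e)
    _ = (∑ e, x e) * vmax := by rw [← Finset.mul_sum, mul_comm]
    _ ≤ _ := mul_le_mul_of_nonneg_right h1 h0

theorem vHat_le_mul {vmax : ℝ} (hmax : ∀ ξ e, I.value ξ e ≤ vmax) (h0 : 0 ≤ vmax) :
    I.vHat S ≤ ((I.nA : ℝ) + I.nB) * vmax := by
  have hN : (0 : ℝ) < I.N := by exact_mod_cast I.N_pos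
  unfold vHat
  rw [one_div, inv_mul_le_iff₀ hN]
  refine (Finset.sum_le_sum fun ξ _ => lpValue_le_mul hmax h0 ξ).trans ?_
  simp

/-- A positive average forces an available trip of positive value in some scenario, and this trip
alone is a feasible assignment. -/
theorem le_mul_vHat_of_pos {vmin : ℝ} (hmin : ∀ ξ e, 0 < I.value ξ e → vmin ≤ I.value ξ e)
    (h : 0 < I.vHat S) : vmin ≤ I.N * I.vHat S := by
  have hN : (0 : ℝ) < I.N := by exact_mod_cast I.N_pos
  have hsum : I.N * I.vHat S = ∑ ξ, I.lpValue S ξ := by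
    unfold vHat
    field_simp
  rw [hsum]
  have h1 : 0 < ∑ ξ, I.lpValue S ξ := hsum ▸ mul_pos hN h
  obtain ⟨ξ, -, hξ⟩ := Finset.exists_lt_of_sum_lt (f := fun _ => (0 : ℝ)) (by simpa using h1)
  refine le_trans ?_ (Finset.single_le_sum (fun ξ _ => lpValue_nonneg) (Finset.mem_univ ξ))
  obtain ⟨x, hx, hv⟩ := I.exists_lpValue_eq S ξ
  rw [hv] at hξ
  obtain ⟨e, -, he⟩ := Finset.exists_lt_of_sum_lt (f := fun _ => (0 : ℝ))
    (by simpa [assignmentValue] using hξ)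
  have hv0 : 0 < I.value ξ e := by
    refine (I.value_nonneg ξ e).lt_of_ne fun h => ?_
    simp [← h] at he
  have hav : I.Available S ξ e := by
    by_contra hav
    simp [hx.eq_zero e hav] at he
  have hf : I.Feasible S ξ (I.indicator ξ {e}) := by
    refine ⟨fun f => ?_, fun j => ?_, fun i => ?_, fun f hf => ?_⟩
    · unfold indicator
      split_ifs <;> simp
    · refine sum_indicator_le_one fun f _ g _ hf hg => ?_
      rw [Finset.mem_singleton.1 hf, Finset.mem_singleton.1 hg]
    · refine sum_indicator_le_one fun f _ g _ hf hg => ?_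
      rw [Finset.mem_singleton.1 hf, Finset.mem_singleton.1 hg]
    · refine if_neg fun h => hf ?_
      rwa [Finset.mem_singleton.1 h]
  refine (hmin ξ e hv0).trans (le_of_eq_of_le ?_ hf.le_lpValue)
  simp [assignmentValue, indicator]

/-- The growth of the value along a sequence of improving swaps. -/
theorem pow_mul_vmin_le {vmin vmax ε : ℝ} (hε : 0 ≤ ε)
    (hmin : ∀ ξ e, 0 < I.value ξ e → vmin ≤ I.value ξ e) (hmax : ∀ ξ e, I.value ξ e ≤ vmax)
    (h0 : 0 ≤ vmax) {k : ℕ} {T : ℕ → Finset (Fin I.nA)}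
    (hT : ∀ j < k + 1, I.ImprovingSwap ε (T j) (T (j + 1))) :
    (1 + ε) ^ k * vmin ≤ I.N * ((I.nA : ℝ) + I.nB) * vmax := by
  have hstep : ∀ j < k + 1, (1 + ε) * I.vHat (T j) < I.vHat (T (j + 1)) := by
    intro j hj
    obtain ⟨i, _, i', _, _, h⟩ := hT j hj
    exact h
  -- The starting value may be zero. The strict first swap only serves to make the value positive;
  -- it is the extra 1 in the bound on the number of swaps.
  have h1 : 0 < I.vHat (T 1) :=
    lt_of_le_of_lt (mul_nonneg (by linarith) vHat_nonneg) (hstep 0 (by omega))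
  have h2 : ∀ j ≤ k, (1 + ε) ^ j * I.vHat (T 1) ≤ I.vHat (T (j + 1)) := by
    intro j hj
    induction j with
    | zero => simp
    | succ j ih =>
      refine le_trans ?_ (hstep (j + 1) (by omega)).le
      rw [pow_succ', mul_assoc]
      exact mul_le_mul_of_nonneg_left (ih (by omega)) (by linarith)
  have h3 := le_mul_vHat_of_pos hmin h1
  have h4 := (h2 k le_rfl).trans (vHat_le_mul hmax h0)
  have hN : (0 : ℝ) < I.N := by exact_mod_cast I.N_pos
  calc (1 + ε) ^ k * vmin ≤ (1 + ε) ^ k * (I.N * I.vHat (T 1)) :=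
        mul_le_mul_of_nonneg_left h3 (pow_nonneg (by linarith) _)
    _ = I.N * ((1 + ε) ^ k * I.vHat (T 1)) := by ring
    _ ≤ I.N * (((I.nA : ℝ) + I.nB) * vmax) := mul_le_mul_of_nonneg_left h4 hN.le
    _ = _ := by ring

theorem swaps_le {vmin vmax : ℝ} (hvmin : 0 < vmin) (hle : vmin ≤ vmax)
    (hmin : ∀ ξ e, 0 < I.value ξ e → vmin ≤ I.value ξ e) (hmax : ∀ ξ e, I.value ξ e ≤ vmax)
    (k : ℕ) (T : ℕ → Finset (Fin I.nA))
    (hT : ∀ j < k, I.ImprovingSwap (I.eps : ℝ) (T j) (T (j + 1))) :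
    (k : ℝ) ≤ 1 + Real.logb (1 + (I.eps : ℝ))
      ((I.N : ℝ) * ((I.nA : ℝ) + (I.nB : ℝ)) * vmax / vmin) := by
  have hε : (0 : ℝ) < (I.eps : ℝ) := by exact_mod_cast I.eps_pos
  have hN : (1 : ℝ) ≤ I.N := by exact_mod_cast I.N_pos
  have hA : (1 : ℝ) ≤ I.nA := by exact_mod_cast I.K_pos.trans_le I.K_le
  have hB : (0 : ℝ) ≤ I.nB := by positivity
  -- Needed for `k = 0`, where the logarithm must not be negative.
  have hratio : 1 ≤ (I.N : ℝ) * ((I.nA : ℝ) + (I.nB : ℝ)) * vmax / vmin := by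
    rw [le_div_iff₀ hvmin, one_mul]
    have h1 : 1 ≤ (I.N : ℝ) * ((I.nA : ℝ) + (I.nB : ℝ)) := by nlinarith
    nlinarith
  cases k with
  | zero =>
    have := Real.logb_nonneg (b := 1 + (I.eps : ℝ)) (by linarith) hratio
    simp only [Nat.cast_zero]
    linarith
  | succ k =>
    have h1 := pow_mul_vmin_le hε.le hmin hmax (by linarith) hT
    have h2 : (k : ℝ) ≤ Real.logb (1 + (I.eps : ℝ))
        ((I.N : ℝ) * ((I.nA : ℝ) + (I.nB : ℝ)) * vmax / vmin) := by
      rw [Real.le_logb_iff_rpow_le (by linarith) (by linarith), Real.rpow_natCast,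
        le_div_iff₀ hvmin]
      exact h1
    push_cast
    linarith

end Iterations

end Instance

/-! ### Rational linear programs have rational optimal values -/

/-- A slack constraint survives small perturbations; a tight one survives when the perturbation does
not affect it. -/
theorem eventually_add_mul_le {a b c : ℝ} (h : a ≤ c) (hb : a = c → b = 0) :
    ∀ᶠ δ in nhds (0 : ℝ), a + δ * b ≤ c := by
  rcases h.eq_or_lt with h | h
  · simp [hb h, h]
  · have h1 : Filter.Tendsto (fun δ : ℝ => a + δ * b) (nhds 0) (nhds (a + 0 * b)) :=
      Continuous.tendsto (by fun_prop) 0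
    rw [zero_mul, add_zero] at h1
    exact (h1.eventually_lt_const h).mono fun _ h => h.le

/-- If the optimum `M` were irrational, some ℚ-linear `φ : ℝ → ℚ` would vanish on ℚ but not at `M`.
Moving an optimal `x` by `δ φ(x)` coordinatewise changes each rational linear form by `δ` times `φ`
of its value. Tight constraints have rational values and do not move, so the point stays feasible
for small `δ` of either sign, while the objective moves by `δ φ(M)`. -/
theorem LP.exists_rat_eq_of_isGreatest (L : LP) {M : ℝ} (hM : IsGreatest L.values M) :
    ∃ r : ℚ, (r : ℝ) = M := by
  by_contra hirr
  have hspan : M ∉ Submodule.span ℚ {(1 : ℝ)} := by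
    rw [Submodule.mem_span_singleton]
    rintro ⟨r, hr⟩
    exact hirr ⟨r, by rw [← hr, Rat.smul_one_eq_cast]⟩
  obtain ⟨φ, hφM, hφ⟩ := Submodule.exists_le_ker_of_notMem hspan
  have hφ1 : φ 1 = 0 := hφ (Submodule.mem_span_singleton_self 1)
  have hmul : ∀ (r : ℚ) (t : ℝ), φ ((r : ℝ) * t) = r * φ t := fun r t => by
    rw [← Rat.smul_def, map_smul, smul_eq_mul]
  have hrat : ∀ r : ℚ, φ (r : ℝ) = 0 := fun r => by
    rw [← mul_one (r : ℝ), hmul, hφ1, mul_zero]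
  have hsum : ∀ (c : Fin L.n → ℚ) (x : Fin L.n → ℝ),
      φ (∑ k, (c k : ℝ) * x k) = ∑ k, c k * φ (x k) := fun c x => by
    rw [map_sum]
    exact Finset.sum_congr rfl fun k _ => hmul _ _
  obtain ⟨⟨x, hx, hxM⟩, hub⟩ := hM
  have hlin : ∀ (c : Fin L.n → ℚ) (δ : ℝ), ∑ k, (c k : ℝ) * (x k + δ * (φ (x k) : ℝ)) =
      ∑ k, (c k : ℝ) * x k + δ * ((φ (∑ k, (c k : ℝ) * x k) : ℚ) : ℝ) := by
    intro c δ
    rw [hsum]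
    push_cast
    rw [Finset.mul_sum, ← Finset.sum_add_distrib]
    exact Finset.sum_congr rfl fun k _ => by ring
  have hfeas : ∀ᶠ δ in nhds (0 : ℝ), L.Feasible fun k => x k + δ * (φ (x k) : ℝ) := by
    refine Filter.Eventually.and ?_ ?_
    · refine Filter.eventually_all.2 fun k => ?_
      have := eventually_add_mul_le (a := -x k) (b := -(φ (x k) : ℝ)) (c := 0)
        (by linarith [hx.1 k]) (fun h => by rw [show x k = 0 by linarith]; simp)
      filter_upwards [this] with δ h
      linarith
    · refine (Filter.eventually_all_finite (List.finite_toSet L.rows)).2 fun r hr => ?_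
      simp only [hlin]
      refine eventually_add_mul_le (hx.2 r hr) fun h => ?_
      rw [h, hrat, Rat.cast_zero]
  have hle : ∀ᶠ δ in nhds (0 : ℝ), δ * (φ M : ℝ) ≤ 0 := by
    filter_upwards [hfeas] with δ h
    have := hub ⟨_, h, rfl⟩
    rw [hlin, ← hxM] at this
    linarith
  have htend : Filter.Tendsto (fun t : ℝ => t * (φ M : ℝ)) (nhdsWithin 0 (Set.Ioi 0)) (nhds 0) := by
    refine Filter.Tendsto.mono_left ?_ nhdsWithin_le_nhds
    exact Continuous.tendsto' (by fun_prop) _ _ (zero_mul _)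
  -- The choice `δ = t φ(M)` with `t > 0` increases the objective whatever the sign of `φ(M)`.
  obtain ⟨t, ht, ht0⟩ := ((htend.eventually hle).and self_mem_nhdsWithin).exists
  have h0 : (φ M : ℝ) ≠ 0 := by exact_mod_cast hφM
  have h1 : 0 < (t : ℝ) * ((φ M : ℝ) * (φ M : ℝ)) :=
    mul_pos ht0 (mul_self_pos.2 h0)
  linarith [mul_assoc t (φ M : ℝ) (φ M : ℝ)]

/-! ### Values and step counts of the basic programs -/

namespace Timed

variable {α β : Type}

@[simp] theorem pure_val (a : α) : (pure a : Timed α).val = a := rfl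

@[simp] theorem pure_time (a : α) : (pure a : Timed α).time = 0 := rfl

@[simp] theorem bind_val (m : Timed α) (f : α → Timed β) : (m >>= f).val = (f m.val).val := rfl

@[simp] theorem bind_time (m : Timed α) (f : α → Timed β) :
    (m >>= f).time = m.time + (f m.val).time := rfl

@[simp] theorem tick_time (n : ℕ) : (tick n).time = n := rfl

@[simp] theorem forList_val (f : α → Timed β) (l : List α) :
    (forList f l).val = l.map fun a => (f a).val := by
  induction l with
  | nil => rfl
  | cons a l ih => simp [forList, ih]

theorem forList_time_le (f : α → Timed β) {l : List α} {T : ℕ} (h : ∀ a ∈ l, (f a).time ≤ T) :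
    (forList f l).time ≤ l.length * (T + 1) := by
  induction l with
  | nil => simp [forList]
  | cons a l ih =>
    have h1 := h a (List.mem_cons_self ..)
    have h2 := ih fun b hb => h b (List.mem_cons_of_mem _ hb)
    simp only [forList, bind_time, tick_time, pure_time, List.length_cons]
    linarith

end Timed

@[simp] theorem sumQ_val (l : List ℚ) : (sumQ l).val = l.sum := by
  induction l with
  | nil => rfl
  | cons a l ih => simp [sumQ, addQ, ih]

/-! ### Correctness of the program -/

namespace Instance

open Timed

variable {alg : LP → Timed ℚ} (I : Instance ℚ) (S : Finset (Fin I.nA)) (ξ : Fin I.N)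

/-- The assignment LP of scenario `ξ` for the selected set `S`. -/
abbrev assignmentLP : LP := ⟨I.nE ξ, I.value ξ,
  (List.finRange (I.nD ξ)).map
    (fun j => ((fun e => if j ∈ I.requests ξ e then 1 else 0), 1)) ++
  (List.finRange I.nA).map
    (fun i => ((fun e => if I.vehicle ξ e = Sum.inl i then 1 else 0), if i ∈ S then 1 else 0)) ++
  (List.finRange I.nB).map
    (fun i => ((fun e => if I.vehicle ξ e = Sum.inr i then 1 else 0), 1))⟩

theorem buildLP_val : (I.buildLP S ξ).val = I.assignmentLP S ξ := by
  simp [buildLP, requestRow, vehicleRow, table]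

theorem feasible_assignmentLP_iff (x : Fin (I.nE ξ) → ℝ) :
    (I.assignmentLP S ξ).Feasible x ↔ (∀ e, 0 ≤ x e) ∧
      (∀ j, ∑ e with j ∈ I.requests ξ e, x e ≤ 1) ∧
      (∀ i, ∑ e with I.vehicle ξ e = Sum.inl i, x e ≤ if i ∈ S then 1 else 0) ∧
      ∀ i, ∑ e with I.vehicle ξ e = Sum.inr i, x e ≤ 1 := by
  simp only [LP.Feasible, List.mem_append, List.mem_map, List.mem_finRange, true_and, or_imp,
    forall_and, forall_exists_index, forall_apply_eq_imp_iff, and_assoc, apply_ite (Rat.cast (K := ℝ)),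
    Rat.cast_one, Rat.cast_zero, ite_mul, one_mul, zero_mul, ← Finset.sum_filter]

/-- For nonnegative `x`, the right-hand side 0 for an unselected vehicle is the same as forbidding
all its trips. -/
theorem feasible_assignmentLP_iff_toReal (x : Fin (I.nE ξ) → ℝ) :
    (I.assignmentLP S ξ).Feasible x ↔ I.toReal.Feasible S ξ x := by
  rw [feasible_assignmentLP_iff]
  constructor
  · rintro ⟨h0, hD, hA, hB⟩
    refine ⟨h0, hD, ?_, fun e he => ?_⟩
    · rintro (i | i)
      · refine (hA i).trans ?_
        split_ifs <;> simp
      · exact hB i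
    · have he' : ¬ ∀ i, I.vehicle ξ e = Sum.inl i → i ∈ S := he
      push Not at he'
      obtain ⟨i, hi, hiS⟩ := he'
      have h1 := hA i
      rw [if_neg hiS] at h1
      refine le_antisymm (le_trans ?_ h1) (h0 e)
      exact Finset.single_le_sum (f := x) (fun f _ => h0 f)
        (Finset.mem_filter.2 ⟨Finset.mem_univ e, hi⟩)
  · rintro ⟨h0, hD, hV, hz⟩
    refine ⟨h0, hD, fun i => ?_, fun i => hV (Sum.inr i)⟩
    split_ifs with hi
    · exact hV (Sum.inl i)
    · refine (Finset.sum_eq_zero fun e he => ?_).le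
      exact hz e fun h => hi (h i (Finset.mem_filter.1 he).2)

theorem values_buildLP : (I.buildLP S ξ).val.values =
    {t | ∃ x, I.toReal.Feasible S ξ x ∧ t = I.toReal.assignmentValue ξ x} := by
  rw [buildLP_val]
  ext t
  constructor
  · rintro ⟨x, hx, rfl⟩
    exact ⟨x, (I.feasible_assignmentLP_iff_toReal S ξ x).1 hx, rfl⟩
  · rintro ⟨x, hx, rfl⟩
    exact ⟨x, (I.feasible_assignmentLP_iff_toReal S ξ x).2 hx, rfl⟩

/-- `IsLPAlgorithm` promises a correct answer only for rational optimal values, so the rationality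
of the optimum is used here. -/
theorem alg_buildLP (halg : IsLPAlgorithm alg) :
    ((alg (I.buildLP S ξ).val).val : ℝ) = I.toReal.lpValue S ξ := by
  have h := isGreatest_lpValue I.toReal S ξ
  have h' : IsGreatest (I.buildLP S ξ).val.values (I.toReal.lpValue S ξ) := by
    rw [values_buildLP]
    exact h
  obtain ⟨r, hr⟩ := LP.exists_rat_eq_of_isGreatest _ h'
  rw [← hr] at h' ⊢
  rw [halg.correct _ r h']

theorem vHatProg_val (alg : LP → Timed ℚ) : (I.vHatProg alg S).val =
    1 / (I.N : ℚ) * ∑ ξ, (alg (I.buildLP S ξ).val).val := by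
  simp [vHatProg, mulQ, List.sum_ofFn, ← List.ofFn_eq_map]

theorem vHatProg_val_eq_vHat (halg : IsLPAlgorithm alg) :
    ((I.vHatProg alg S).val : ℝ) = I.toReal.vHat S := by
  rw [vHatProg_val]
  push_cast
  unfold vHat
  congr 1
  exact Finset.sum_congr rfl fun ξ _ => I.alg_buildLP S ξ halg

variable {I S}

theorem mem_swapPairs {q : Fin I.nA × Fin I.nA} :
    q ∈ (I.swapPairs S).val ↔ q.1 ∈ S ∧ q.2 ∉ S := by
  rcases q with ⟨i, i'⟩
  simp [swapPairs]

theorem bestSwap_val (l : List (Fin I.nA × Fin I.nA)) :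
    (l = [] ∧ (I.bestSwap alg S l).val = none) ∨
    ∃ q ∈ l, (I.bestSwap alg S l).val =
        some (I.swap S q.1 q.2, (I.vHatProg alg (I.swap S q.1 q.2)).val) ∧
      ∀ q' ∈ l, (I.vHatProg alg (I.swap S q'.1 q'.2)).val ≤
        (I.vHatProg alg (I.swap S q.1 q.2)).val := by
  induction l with
  | nil => exact Or.inl ⟨rfl, rfl⟩
  | cons a l ih =>
    right
    rcases ih with ⟨rfl, h⟩ | ⟨q, hq, h, hmax⟩
    · exact ⟨a, List.mem_cons_self .., by simp [bestSwap, better], by simp⟩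
    · by_cases hlt : (I.vHatProg alg (I.swap S q.1 q.2)).val <
        (I.vHatProg alg (I.swap S a.1 a.2)).val
      · refine ⟨a, List.mem_cons_self .., ?_, ?_⟩
        · simp [bestSwap, h, better, ltQ, hlt]
        · rintro q' hq'
          rcases List.mem_cons.1 hq' with rfl | hq'
          · exact le_rfl
          · exact (hmax q' hq').trans hlt.le
      · refine ⟨q, List.mem_cons_of_mem _ hq, ?_, ?_⟩
        · simp [bestSwap, h, better, ltQ, hlt]
        · rintro q' hq'
          rcases List.mem_cons.1 hq' with rfl | hq'
          · exact not_lt.1 hlt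
          · exact hmax q' hq'

theorem lt_iff_improving (halg : IsLPAlgorithm alg) (ε : ℚ) (S S' : Finset (Fin I.nA)) :
    (1 + ε) * (I.vHatProg alg S).val < (I.vHatProg alg S').val ↔
      (1 + (ε : ℝ)) * I.toReal.vHat S < I.toReal.vHat S' := by
  rw [← vHatProg_val_eq_vHat I S halg, ← vHatProg_val_eq_vHat I S' halg]
  exact_mod_cast Iff.rfl

theorem improvingSwap_of_localSwap (halg : IsLPAlgorithm alg) {ε : ℚ} {S' : Finset (Fin I.nA)}
    (h : (I.localSwap alg ε S).val = some S') : I.toReal.ImprovingSwap (ε : ℝ) S S' := by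
  rcases bestSwap_val (alg := alg) (S := S) (I.swapPairs S).val with ⟨-, h1⟩ | ⟨q, hq, h1, -⟩
  · simp [localSwap, h1, accept] at h
  · rw [mem_swapPairs] at hq
    simp only [localSwap, bind_val, h1, accept, mulQ, ltQ, pure_val] at h
    split_ifs at h with hlt
    obtain rfl := Option.some.inj h
    exact ⟨q.1, hq.1, q.2, hq.2, rfl, (lt_iff_improving halg ε S _).1 (by simpa using hlt)⟩

/-- The returned candidate is a best one, so if it misses the threshold, every swap does. -/
theorem halted_of_localSwap (halg : IsLPAlgorithm alg) {ε : ℚ}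
    (h : (I.localSwap alg ε S).val = none) (S' : Finset (Fin I.nA)) :
    ¬ I.toReal.ImprovingSwap (ε : ℝ) S S' := by
  rintro ⟨i, hi, i', hi', rfl, hlt⟩
  change Fin I.nA at i i'
  have hmem : (i, i') ∈ (I.swapPairs S).val := mem_swapPairs.2 ⟨hi, hi'⟩
  rcases bestSwap_val (alg := alg) (S := S) (I.swapPairs S).val with ⟨h0, -⟩ | ⟨q, hq, h1, hmax⟩
  · rw [h0] at hmem
    exact List.not_mem_nil hmem
  · simp only [localSwap, bind_val, h1, accept, mulQ, ltQ, pure_val] at h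
    split_ifs at h with hle
    have h2 := (lt_iff_improving halg ε S (I.swap S i i')).2 hlt
    have h3 := hmax (i, i') hmem
    exact hle (decide_eq_true (h2.trans_le h3))

theorem insertTrip_val_perm (e : Fin (I.nE ξ)) (l : List (Fin (I.nE ξ))) :
    (I.insertTrip ξ e l).val.Perm (e :: l) := by
  induction l with
  | nil => exact List.Perm.refl _
  | cons f l ih =>
    simp only [insertTrip, bind_val]
    split_ifs
    · exact (ih.cons f).trans (List.Perm.swap e f l)
    · exact List.Perm.refl _

theorem insertTrip_val_pairwise (e : Fin (I.nE ξ)) {l : List (Fin (I.nE ξ))}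
    (hl : l.Pairwise (fun e f => I.value ξ f ≤ I.value ξ e)) :
    (I.insertTrip ξ e l).val.Pairwise (fun e f => I.value ξ f ≤ I.value ξ e) := by
  induction l with
  | nil => simp [insertTrip]
  | cons f l ih =>
    rw [List.pairwise_cons] at hl
    simp only [insertTrip, bind_val, ltQ]
    split_ifs with h
    · rw [decide_eq_true_eq] at h
      refine List.pairwise_cons.2 ⟨fun g hg => ?_, ih hl.2⟩
      rcases List.mem_cons.1 ((insertTrip_val_perm ξ e l).mem_iff.1 hg) with rfl | hg
      · exact h.le
      · exact hl.1 g hg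
    · rw [decide_eq_true_eq, not_lt] at h
      refine List.pairwise_cons.2 ⟨fun g hg => ?_, List.pairwise_cons.2 hl⟩
      rcases List.mem_cons.1 hg with rfl | hg
      · exact h
      · exact (hl.1 g hg).trans h

theorem sortTrips_val (l : List (Fin (I.nE ξ))) :
    (I.sortTrips ξ l).val.Perm l ∧
      (I.sortTrips ξ l).val.Pairwise (fun e f => I.value ξ f ≤ I.value ξ e) := by
  induction l with
  | nil => exact ⟨List.Perm.refl _, List.Pairwise.nil⟩
  | cons e l ih =>
    exact ⟨(insertTrip_val_perm ξ e _).trans (ih.1.cons e), insertTrip_val_pairwise ξ e ih.2⟩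

theorem scanProg_val (l c : List (Fin (I.nE ξ))) :
    (I.scanProg ξ l c).val = I.greedyScan ξ l c := by
  induction l generalizing c with
  | nil => rfl
  | cons e l ih =>
    simp only [scanProg, bind_val, disjointTest, decide_eq_true_eq]
    unfold greedyScan
    split_ifs <;> exact ih _

/-- The scan never reads the values. -/
theorem greedyScan_toReal (l c : List (Fin (I.nE ξ))) :
    I.toReal.greedyScan ξ l c = I.greedyScan ξ l c := by
  induction l generalizing c with
  | nil => rfl
  | cons e l ih =>
    by_cases h : ∀ f ∈ c, I.DisjointTrips ξ e f
    · exact (if_pos h).trans ((ih (e :: c)).trans (if_pos h).symm)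
    · exact (if_neg h).trans ((ih c).trans (if_neg h).symm)

theorem isGreedy_greedyProg : I.toReal.IsGreedy S ξ (I.greedyProg S ξ).val := by
  have hs := sortTrips_val ξ (I.availableTrips S ξ).val
  refine ⟨(I.sortTrips ξ (I.availableTrips S ξ).val).val, ?_, fun e => ?_, ?_, ?_⟩
  · exact hs.1.nodup_iff.2 ((List.nodup_finRange _).filter _)
  · change Fin (I.nE ξ) at e
    refine (hs.1.mem_iff (a := e)).trans ?_
    change _ ↔ I.Available S ξ e
    simp [availableTrips]
  · exact hs.2.imp fun {e f} h => (Rat.cast_le (K := ℝ)).2 h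
  · refine Eq.trans ?_ (congrArg List.toFinset (greedyScan_toReal ξ _ []).symm)
    rw [← scanProg_val]
    rfl

end Instance

/-! ### Bit lengths -/

theorem natAbs_num_lt_of_bits_le {q : ℚ} {T : ℕ} (h : bits q ≤ T) : q.num.natAbs < 2 ^ T :=
  Nat.size_le.1 (by unfold bits at h; omega)

theorem den_lt_of_bits_le {q : ℚ} {T : ℕ} (h : bits q ≤ T) : q.den < 2 ^ T :=
  Nat.size_le.1 (by unfold bits at h; omega)

theorem bits_le_of_lt {q : ℚ} {a b : ℕ} (h1 : q.num.natAbs < 2 ^ a) (h2 : q.den < 2 ^ b) :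
    bits q ≤ a + b + 1 := by
  have h3 := Nat.size_le.2 h1
  have h4 := Nat.size_le.2 h2
  unfold bits
  omega

/-- Reduction to lowest terms only shrinks a fraction, so bit lengths can be estimated on unreduced
ones. -/
theorem natAbs_num_le_and_den_le {q : ℚ} {n : ℤ} {d : ℕ} (hd : d ≠ 0) (h : q = (n : ℚ) / d) :
    q.num.natAbs ≤ n.natAbs ∧ q.den ≤ d := by
  have hd' : (d : ℤ) ≠ 0 := by exact_mod_cast hd
  have hq : q = Rat.divInt n d := by rw [h, Rat.divInt_eq_div, Int.cast_natCast]
  constructor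
  · rcases eq_or_ne n 0 with rfl | hn
    · simp [h]
    · exact Nat.le_of_dvd (Int.natAbs_pos.2 hn) (Int.natAbs_dvd_natAbs.2 (hq ▸ Rat.num_dvd n hd'))
  · refine Nat.le_of_dvd (Nat.pos_of_ne_zero hd) ?_
    exact Int.natCast_dvd_natCast.1 (hq ▸ Rat.den_dvd n d)

/-- A bound linear in the numbers themselves suffices, as it is applied to expressions in p, K and
N, which the input length counts in unary or dominates. -/
theorem bits_natCast_div_le (a : ℕ) {b : ℕ} (hb : b ≠ 0) : bits ((a : ℚ) / b) ≤ a + b + 1 := by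
  obtain ⟨h1, h2⟩ := natAbs_num_le_and_den_le (q := (a : ℚ) / b) (n := a) hb (by simp)
  exact bits_le_of_lt (h1.trans_lt (by simpa using Nat.lt_two_pow_self))
    (h2.trans_lt Nat.lt_two_pow_self)

theorem bits_mul_le (a b : ℚ) : bits (a * b) ≤ bits a + bits b := by
  have h : a * b = ((a.num * b.num : ℤ) : ℚ) / (a.den * b.den : ℕ) := by
    conv_lhs => rw [← Rat.num_div_den a, ← Rat.num_div_den b]
    push_cast
    rw [div_mul_div_comm]
  obtain ⟨h1, h2⟩ := natAbs_num_le_and_den_le (Nat.mul_ne_zero a.den_nz b.den_nz) h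
  rw [Int.natAbs_mul] at h1
  have h3 := bits_le_of_lt (a := a.num.natAbs.size + b.num.natAbs.size)
    (b := a.den.size + b.den.size)
    (h1.trans_lt (by rw [pow_add]; exact Nat.mul_lt_mul'' (Nat.lt_size_self _) (Nat.lt_size_self _)))
    (h2.trans_lt (by rw [pow_add]; exact Nat.mul_lt_mul'' (Nat.lt_size_self _) (Nat.lt_size_self _)))
  unfold bits at h3 ⊢
  omega

/-- The product of all denominators is a common denominator, so lengths add up along the list; the
factor `l.length` in the numerator counts the terms. -/
theorem sum_num_den_le {T : ℕ} {l : List ℚ} (h : ∀ a ∈ l, bits a ≤ T) :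
    l.sum.num.natAbs ≤ l.length * 2 ^ (l.length * T) ∧ l.sum.den ≤ 2 ^ (l.length * T) := by
  induction l with
  | nil => simp
  | cons a l ih =>
    obtain ⟨h1, h2⟩ := ih fun b hb => h b (List.mem_cons_of_mem _ hb)
    have ha := h a (List.mem_cons_self ..)
    have h3 := (natAbs_num_lt_of_bits_le ha).le
    have h4 := (den_lt_of_bits_le ha).le
    have hq : (a :: l).sum = ((a.num * l.sum.den + l.sum.num * a.den : ℤ) : ℚ) /
        (a.den * l.sum.den : ℕ) := by
      rw [List.sum_cons]
      conv_lhs => rw [← Rat.num_div_den a, ← Rat.num_div_den l.sum]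
      have h5 : (a.den : ℚ) ≠ 0 := by exact_mod_cast a.den_nz
      have h6 : (l.sum.den : ℚ) ≠ 0 := by exact_mod_cast l.sum.den_nz
      push_cast
      rw [div_add_div _ _ h5 h6]
      ring
    obtain ⟨h5, h6⟩ := natAbs_num_le_and_den_le (Nat.mul_ne_zero a.den_nz l.sum.den_nz) hq
    have hpow : 2 ^ ((a :: l).length * T) = 2 ^ T * 2 ^ (l.length * T) := by
      rw [← pow_add, List.length_cons]
      ring
    rw [hpow]
    refine ⟨h5.trans ((Int.natAbs_add_le _ _).trans ?_), h6.trans (Nat.mul_le_mul h4 h2)⟩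
    rw [Int.natAbs_mul, Int.natAbs_mul, Int.natAbs_natCast, Int.natAbs_natCast]
    have h7 := Nat.mul_le_mul h3 h2
    have h8 := Nat.mul_le_mul h1 h4
    rw [List.length_cons]
    linarith

theorem bits_sum_le {T : ℕ} {l : List ℚ} (h : ∀ a ∈ l, bits a ≤ T) :
    bits l.sum ≤ 2 * (l.length * (T + 1)) + 2 := by
  obtain ⟨h1, h2⟩ := sum_num_den_le h
  -- The factor `l.length` is below `2 ^ l.length`, which turns `T` into `T + 1`.
  have h3 : l.length * 2 ^ (l.length * T) < 2 ^ (l.length * (T + 1)) := by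
    rw [mul_add, mul_one, pow_add, mul_comm]
    exact Nat.mul_lt_mul_of_pos_left Nat.lt_two_pow_self (by positivity)
  have h4 : 2 ^ (l.length * T) < 2 ^ (l.length * T + 1) :=
    Nat.pow_lt_pow_right (by norm_num) (by omega)
  have h5 := bits_le_of_lt (h1.trans_lt h3) (h2.trans_lt h4)
  rw [mul_add, mul_one] at h5 ⊢
  omega

theorem opCost_le {a b : ℚ} {A B : ℕ} (ha : bits a ≤ A) (hb : bits b ≤ B) :
    opCost a b ≤ (A + B) ^ 2 :=
  Nat.pow_le_pow_left (Nat.add_le_add ha hb) 2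

theorem sumQ_time_le {T n : ℕ} {l : List ℚ} (h : ∀ a ∈ l, bits a ≤ T) (hn : l.length ≤ n) :
    (sumQ l).time ≤ l.length * (T + (2 * (n * (T + 1)) + 2)) ^ 2 := by
  induction l with
  | nil => simp [sumQ]
  | cons a l ih =>
    have hl : ∀ b ∈ l, bits b ≤ T := fun b hb => h b (List.mem_cons_of_mem _ hb)
    rw [List.length_cons] at hn
    have h1 := ih hl (by omega)
    have h2 : bits l.sum ≤ 2 * (n * (T + 1)) + 2 :=
      (bits_sum_le hl).trans (by gcongr; omega)
    have h3 := opCost_le (h a (List.mem_cons_self ..)) h2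
    simp only [sumQ, Timed.bind_time, sumQ_val, addQ, List.length_cons]
    linarith

/-! ### Step counts -/

/-! ### Bounds over any commutative semiring, to be read as numbers and, at `Polynomial.X`, as
polynomials. -/

section Bounds

variable {R : Type*} [CommSemiring R]

/-- Bound for the encoding length of the assignment linear programs. -/
def lpSizeBound (L : R) : R := 1 + 2 * L + 3 * L * (3 + 3 * L)

/-- Bound for the time of writing down an assignment linear program. -/
def buildBound (L : R) : R := 2 * L + L * (2 * L + 1) + 2 * (L * (3 * L + 2)) + 3 * L

/-- Bound for the bit length of the sum of the values of the linear programs. -/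
def sumBits (L T : R) : R := 2 * (L * (T + 1)) + 2

/-- Bound for the bit length of the average of the values of the linear programs. -/
def avgBits (L T : R) : R := L + 2 + sumBits L T

/-- Bound for the time of evaluating the average value of a solution. -/
def vHatBound (L T : R) : R :=
  L * (buildBound L + T + 1) + L * (T + sumBits L T) ^ 2 + (L + 2 + sumBits L T) ^ 2

/-- Bound for the time of comparing a value with the threshold of the stopping rule. -/
def acceptBound (L T : R) : R :=
  (2 * L ^ 3 + 2 + avgBits L T) ^ 2 + (2 * L ^ 3 + 2 + avgBits L T + avgBits L T) ^ 2

/-- Bound for the time of one local swap. -/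
def localSwapBound (L T : R) : R :=
  vHatBound L T + (L * (L + 1) + L * L) +
    L * L * (L + 1 + vHatBound L T + (avgBits L T + avgBits L T) ^ 2) + acceptBound L T

/-- Bound for the time of the greedy algorithm in one scenario. -/
def greedyBound (L : R) : R :=
  L * (L + 1) + L * (1 + L * (L + L) ^ 2) + L * (1 + L * (1 + L * L))

/-- Bound for the running time of the whole algorithm. -/
def runBound (L T : R) : R :=
  L + (L * L ^ 2 * (3 * L + 1) + 1) * localSwapBound L T + L * (greedyBound L + 1)

end Bounds

theorem list_sum_map_le {α : Type*} (f : α → ℕ) {l : List α} {B : ℕ} (h : ∀ a ∈ l, f a ≤ B) :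
    (l.map f).sum ≤ l.length * B := by
  have := List.sum_le_card_nsmul (l.map f) B (by simpa using h)
  simpa using this

namespace Instance

open Timed

variable {alg : LP → Timed ℚ} (I : Instance ℚ) (S : Finset (Fin I.nA)) (ξ : Fin I.N)

theorem sum_sizes_le : I.p + I.nA + I.nB + I.N +
    (I.nD ξ + ∑ e, (1 + (I.requests ξ e).card + bits (I.value ξ e))) ≤ I.size := by
  have h := Finset.single_le_sum (f := fun ξ => I.nD ξ + ∑ j, Nat.size (I.passengers ξ j) +
      ∑ e, (1 + (I.requests ξ e).card + bits (I.value ξ e))) (fun _ _ => Nat.zero_le _)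
      (Finset.mem_univ ξ)
  unfold size
  omega

theorem sum_trips_le :
    ∑ e, (1 + (I.requests ξ e).card + bits (I.value ξ e)) ≤ I.size := by
  have := I.sum_sizes_le ξ
  omega

theorem nE_le : I.nE ξ ≤ I.size := by
  refine le_trans ?_ (I.sum_trips_le ξ)
  calc I.nE ξ = ∑ e : Fin (I.nE ξ), 1 := by simp
    _ ≤ _ := Finset.sum_le_sum fun e _ => by omega

theorem trip_le (e : Fin (I.nE ξ)) :
    1 + (I.requests ξ e).card + bits (I.value ξ e) ≤ I.size :=
  (Finset.single_le_sum (f := fun e => 1 + (I.requests ξ e).card + bits (I.value ξ e))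
    (fun _ _ => Nat.zero_le _) (Finset.mem_univ e)).trans (I.sum_trips_le ξ)

theorem nA_le : I.nA ≤ I.size := by
  unfold size
  omega

theorem nB_le : I.nB ≤ I.size := by
  unfold size
  omega

theorem N_le : I.N ≤ I.size := by
  unfold size
  omega

theorem card_le : S.card ≤ I.size :=
  (card_finset_fin_le S).trans I.nA_le

theorem size_buildLP_le : (I.buildLP S ξ).val.size ≤ lpSizeBound I.size := by
  rw [buildLP_val]
  have hL := I.sum_sizes_le ξ
  have hE := I.nE_le ξ
  -- `bits 0 = 2` and `bits 1 = 3`.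
  have h01 : ∀ c : Prop, ∀ _ : Decidable c, bits (if c then 1 else 0) ≤ 3 := by
    intro c _
    split_ifs <;> decide
  have hobj : ∑ e, bits (I.value ξ e) ≤ I.size :=
    (Finset.sum_le_sum fun e _ => by omega).trans (I.sum_trips_le ξ)
  have hrow : ∀ r ∈ (I.assignmentLP S ξ).rows, bits r.2 + ∑ k, bits (r.1 k) ≤ 3 + 3 * I.size := by
    have h : ∀ c : Fin (I.nE ξ) → Prop, ∀ _ : DecidablePred c,
        ∑ e, bits (if c e then 1 else 0) ≤ 3 * I.size := by
      intro c _
      calc ∑ e, bits (if c e then 1 else 0) ≤ ∑ e : Fin (I.nE ξ), 3 :=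
            Finset.sum_le_sum fun e _ => h01 _ _
        _ = 3 * I.nE ξ := by simp [mul_comm]
        _ ≤ _ := by omega
    intro r hr
    simp only [List.mem_append, List.mem_map, List.mem_finRange, true_and] at hr
    have h1 : bits 1 ≤ 3 := by decide
    rcases hr with (⟨j, rfl⟩ | ⟨i, rfl⟩) | ⟨i, rfl⟩
    · exact Nat.add_le_add h1 (h _ _)
    · exact Nat.add_le_add (h01 _ _) (h _ _)
    · exact Nat.add_le_add h1 (h _ _)
  have hrows := list_sum_map_le (fun r : (Fin (I.nE ξ) → ℚ) × ℚ => bits r.2 + ∑ k, bits (r.1 k)) hrow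
  have hlen : (I.assignmentLP S ξ).rows.length ≤ 3 * I.size := by
    simp only [List.length_append, List.length_map, List.length_finRange]
    omega
  have h2 := Nat.mul_le_mul_right (3 + 3 * I.size) hlen
  unfold LP.size lpSizeBound
  have h3 : (I.assignmentLP S ξ).n ≤ I.size := hE
  have h4 : ∑ k, bits ((I.assignmentLP S ξ).obj k) ≤ I.size := hobj
  exact (Nat.add_le_add (Nat.add_le_add (Nat.add_le_add le_rfl h3) h4) (hrows.trans h2)).trans
    (by omega)

theorem requestRow_time_le (j : Fin (I.nD ξ)) : (I.requestRow ξ j).time ≤ 2 * I.size := by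
  have h1 := I.sum_trips_le ξ
  have h2 := I.nE_le ξ
  have h3 : ∑ e, ((I.requests ξ e).card + 1 + 1) ≤
      ∑ e, (1 + (I.requests ξ e).card + bits (I.value ξ e)) + ∑ e : Fin (I.nE ξ), 1 := by
    rw [← Finset.sum_add_distrib]
    exact Finset.sum_le_sum fun e _ => by omega
  simp only [Finset.sum_const, Finset.card_univ, Fintype.card_fin, smul_eq_mul, mul_one] at h3
  simp only [requestRow, table, bind_time, pure_time]
  omega

theorem vehicleRow_time_le (i : Fin I.nA ⊕ Fin I.nB) :
    (I.vehicleRow S ξ i).time ≤ 3 * I.size + 1 := by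
  have h2 := I.nE_le ξ
  have h3 := I.card_le S
  simp only [vehicleRow, table, bind_time, pure_time, tick_time, Finset.sum_const,
    Finset.card_univ, Fintype.card_fin, smul_eq_mul]
  omega

theorem buildLP_time_le : (I.buildLP S ξ).time ≤ buildBound I.size := by
  have hL := I.sum_sizes_le ξ
  have hobj : ∑ e, (bits (I.value ξ e) + 1) ≤ I.size :=
    (Finset.sum_le_sum fun e _ => by omega).trans (I.sum_trips_le ξ)
  have hD := forList_time_le (I.requestRow ξ) (l := List.finRange (I.nD ξ))
    fun j _ => I.requestRow_time_le ξ j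
  have hA := forList_time_le (fun i => I.vehicleRow S ξ (Sum.inl i)) (l := List.finRange I.nA)
    fun i _ => I.vehicleRow_time_le S ξ _
  have hB := forList_time_le (fun i => I.vehicleRow S ξ (Sum.inr i)) (l := List.finRange I.nB)
    fun i _ => I.vehicleRow_time_le S ξ _
  rw [List.length_finRange] at hD hA hB
  have h1 : I.nD ξ * (2 * I.size + 1) ≤ I.size * (2 * I.size + 1) :=
    Nat.mul_le_mul_right _ (by omega)
  have h2 : I.nA * (3 * I.size + 1 + 1) ≤ I.size * (3 * I.size + 2) :=
    Nat.mul_le_mul_right _ I.nA_le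
  have h3 : I.nB * (3 * I.size + 1 + 1) ≤ I.size * (3 * I.size + 2) :=
    Nat.mul_le_mul_right _ I.nB_le
  simp only [buildLP, bind_time, pure_time, tick_time, forList_val, List.length_map,
    List.length_finRange, table, buildBound]
  omega

variable {T : ℕ}

/-- The LP values have at most `T` bits because the LP algorithm must write them down within its
running time. -/
theorem vHatProg_bounds (halg : IsLPAlgorithm alg)
    (hT : ∀ S ξ, (alg (I.buildLP S ξ).val).time ≤ T) :
    (I.vHatProg alg S).time ≤ vHatBound I.size T ∧
      bits (I.vHatProg alg S).val ≤ avgBits I.size T := by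
  set l : List ℚ := (forList (fun ξ => do
    let L ← I.buildLP S ξ
    alg L) (List.finRange I.N)).val with hl
  have hlen : l.length = I.N := by simp [hl]
  have hbits : ∀ a ∈ l, bits a ≤ T := by
    intro a ha
    simp only [hl, forList_val, List.mem_map, bind_val] at ha
    obtain ⟨ξ, -, rfl⟩ := ha
    exact (halg.output_le _).trans (hT S ξ)
  have h1 := forList_time_le (fun ξ => do
    let L ← I.buildLP S ξ
    alg L) (l := List.finRange I.N) (T := buildBound I.size + T)
    fun ξ _ => Nat.add_le_add (I.buildLP_time_le S ξ) (hT S ξ)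
  have hN := I.N_le
  have h2 := sumQ_time_le hbits (hlen.trans_le hN)
  have h3 : bits l.sum ≤ sumBits I.size T := by
    refine (bits_sum_le hbits).trans ?_
    rw [hlen]
    unfold sumBits
    gcongr
  have h4 : bits (1 / (I.N : ℚ)) ≤ I.size + 2 := by
    have := bits_natCast_div_le 1 I.N_pos.ne'
    rw [Nat.cast_one] at this
    omega
  have h5 := opCost_le h4 h3
  rw [List.length_finRange] at h1
  rw [hlen] at h2
  have h6 := Nat.mul_le_mul_right (buildBound I.size + T + 1) hN
  have h7 := Nat.mul_le_mul_right ((T + sumBits I.size T) ^ 2) hN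
  constructor
  · have h8 : (I.vHatProg alg S).time = (forList (fun ξ => do
        let L ← I.buildLP S ξ
        alg L) (List.finRange I.N)).time + ((sumQ l).time + opCost (1 / (I.N : ℚ)) l.sum) := by
      simp only [vHatProg, bind_time, mulQ, sumQ_val, hl]
    rw [h8, vHatBound]
    have h9 := h2.trans h7
    have h10 := h1.trans h6
    omega
  · have h8 : (I.vHatProg alg S).val = 1 / (I.N : ℚ) * l.sum := by
      simp only [vHatProg, bind_val, mulQ, sumQ_val, hl]
    rw [h8]
    exact (bits_mul_le _ _).trans (Nat.add_le_add h4 h3)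

theorem swapPairs_bounds : (I.swapPairs S).val.length ≤ I.size * I.size ∧
    (I.swapPairs S).time ≤ I.size * (I.size + 1) + I.size * I.size := by
  have h1 : (I.swapPairs S).val.length ≤ I.size * I.size := by
    have h : ∀ c : Fin I.nA → Bool, ((List.finRange I.nA).filter c).length ≤ I.size := fun c =>
      (List.length_filter_le _ _).trans (by simpa using I.nA_le)
    simp only [swapPairs, List.product.eq_1, List.length_flatMap, List.length_map]
    rw [List.map_const', List.sum_replicate, smul_eq_mul]
    exact Nat.mul_le_mul (h _) (h _)
  refine ⟨h1, Nat.add_le_add ?_ h1⟩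
  exact Nat.mul_le_mul I.nA_le (Nat.add_le_add_right (I.card_le S) 1)

theorem bestSwap_time_le (halg : IsLPAlgorithm alg)
    (hT : ∀ S ξ, (alg (I.buildLP S ξ).val).time ≤ T) (l : List (Fin I.nA × Fin I.nA)) :
    (I.bestSwap alg S l).time ≤ l.length *
      (I.size + 1 + vHatBound I.size T + (avgBits I.size T + avgBits I.size T) ^ 2) := by
  induction l with
  | nil => simp [bestSwap]
  | cons a l ih =>
    have h1 := I.vHatProg_bounds (I.swap S a.1 a.2) halg hT
    have h2 := I.card_le S
    have h3 : (I.better (I.swap S a.1 a.2, (I.vHatProg alg (I.swap S a.1 a.2)).val)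
        (I.bestSwap alg S l).val).time ≤ (avgBits I.size T + avgBits I.size T) ^ 2 := by
      rcases bestSwap_val (alg := alg) (S := S) l with ⟨-, h⟩ | ⟨q, -, h, -⟩
      · simp [h, better]
      · simp only [h, better, bind_time, ltQ, pure_time]
        exact opCost_le (I.vHatProg_bounds _ halg hT).2 h1.2
    simp only [bestSwap, bind_time, tick_time, List.length_cons, add_one_mul]
    have h4 := h1.1
    omega

/-- `1 + ε` is the fraction (pK² + 1) / (pK²), and p and K are at most the input length. -/
theorem bits_one_add_eps_le : bits (1 + I.eps) ≤ 2 * I.size ^ 3 + 2 := by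
  have hp : I.p ≤ I.size := by
    unfold size
    omega
  have hK : I.K ≤ I.size := I.K_le.trans I.nA_le
  have h0 : I.p * I.K ^ 2 ≠ 0 := (Nat.mul_pos I.p_pos (pow_pos I.K_pos 2)).ne'
  have h1 : 1 + I.eps = ((I.p * I.K ^ 2 + 1 : ℕ) : ℚ) / ((I.p * I.K ^ 2 : ℕ) : ℚ) := by
    have h2 : ((I.p * I.K ^ 2 : ℕ) : ℚ) ≠ 0 := by exact_mod_cast h0
    rw [Nat.cast_add, add_div, div_self h2]
    simp [eps]
  rw [h1]
  refine (bits_natCast_div_le _ h0).trans ?_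
  have h3 : I.p * I.K ^ 2 ≤ I.size * I.size ^ 2 := by gcongr
  rw [show I.size ^ 3 = I.size * I.size ^ 2 by ring]
  omega

theorem localSwap_time_le (halg : IsLPAlgorithm alg)
    (hT : ∀ S ξ, (alg (I.buildLP S ξ).val).time ≤ T) :
    (I.localSwap alg I.eps S).time ≤ localSwapBound I.size T := by
  have h1 := I.vHatProg_bounds S halg hT
  have h2 := I.swapPairs_bounds S
  have h3 := (I.bestSwap_time_le S halg hT (I.swapPairs S).val).trans
    (Nat.mul_le_mul_right _ h2.1)
  have h4 : (accept I I.eps (I.vHatProg alg S).val (I.bestSwap alg S (I.swapPairs S).val).val).time ≤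
      acceptBound I.size T := by
    rcases bestSwap_val (alg := alg) (S := S) (I.swapPairs S).val with ⟨-, h⟩ | ⟨q, -, h, -⟩
    · simp [h, accept]
    · simp only [h, accept, bind_time, mulQ, ltQ, pure_time]
      have h5 := I.bits_one_add_eps_le
      exact Nat.add_le_add (opCost_le h5 h1.2)
        (opCost_le ((bits_mul_le _ _).trans (Nat.add_le_add h5 h1.2))
          (I.vHatProg_bounds _ halg hT).2)
  have h5 := h1.1
  have h6 := h2.2
  simp only [localSwap, bind_time]
  unfold localSwapBound
  omega

/-! ### The greedy algorithm -/

theorem insertTrip_time_le (e : Fin (I.nE ξ)) (l : List (Fin (I.nE ξ))) :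
    (I.insertTrip ξ e l).time ≤ 1 + l.length * (I.size + I.size) ^ 2 := by
  induction l with
  | nil => simp [insertTrip]
  | cons f l ih =>
    have h0 : ∀ e, bits (I.value ξ e) ≤ I.size := fun e => by
      have := I.trip_le ξ e
      omega
    have h1 := opCost_le (h0 e) (h0 f)
    simp only [insertTrip, bind_time, ltQ, List.length_cons, add_one_mul]
    split_ifs
    · simp only [bind_time, pure_time]
      omega
    · simp only [pure_time]
      omega

theorem sortTrips_time_le {l : List (Fin (I.nE ξ))} (hl : l.length ≤ I.size) :
    (I.sortTrips ξ l).time ≤ l.length * (1 + I.size * (I.size + I.size) ^ 2) := by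
  induction l with
  | nil => simp [sortTrips]
  | cons e l ih =>
    rw [List.length_cons] at hl
    have h1 := ih (by omega)
    have h2 := I.insertTrip_time_le ξ e (I.sortTrips ξ l).val
    rw [(sortTrips_val ξ l).1.length_eq] at h2
    have h3 : l.length * (I.size + I.size) ^ 2 ≤ I.size * (I.size + I.size) ^ 2 :=
      Nat.mul_le_mul_right _ (by omega)
    simp only [sortTrips, bind_time, List.length_cons, add_one_mul]
    omega

/-- Moving a trip from `l` to `c` keeps the sum of the lengths, so every disjointness test faces at
most `I.size` kept trips. -/
theorem scanProg_time_le (l c : List (Fin (I.nE ξ))) (hl : l.length + c.length ≤ I.size) :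
    (I.scanProg ξ l c).time ≤ l.length * (1 + I.size * (1 + I.size * I.size)) := by
  induction l generalizing c with
  | nil => simp [scanProg]
  | cons e l ih =>
    rw [List.length_cons] at hl
    have hr : ∀ e, (I.requests ξ e).card ≤ I.size := fun e => by
      have := I.trip_le ξ e
      omega
    have h1 : (I.disjointTest ξ e c).time ≤ 1 + I.size * (1 + I.size * I.size) := by
      refine Nat.add_le_add_left ((list_sum_map_le _ fun f _ =>
        Nat.add_le_add_left (Nat.mul_le_mul (hr e) (hr f)) 1).trans ?_) 1
      exact Nat.mul_le_mul_right _ (by omega)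
    simp only [scanProg, bind_time, List.length_cons, add_one_mul]
    split_ifs
    · have := ih (e :: c) (by simp only [List.length_cons]; omega)
      omega
    · have := ih c (by omega)
      omega

theorem greedyProg_time_le : (I.greedyProg S ξ).time ≤ greedyBound I.size := by
  set l := (I.availableTrips S ξ).val with hl
  have hlen : l.length ≤ I.size :=
    (List.length_filter_le _ _).trans (by simpa using I.nE_le ξ)
  have h1 : (I.availableTrips S ξ).time ≤ I.size * (I.size + 1) :=
    Nat.mul_le_mul (I.nE_le ξ) (Nat.add_le_add_right (I.card_le S) 1)
  have h2 := (I.sortTrips_time_le ξ hlen).trans (Nat.mul_le_mul_right _ hlen)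
  have h3 := I.scanProg_time_le ξ (I.sortTrips ξ l).val []
    (by simpa [(sortTrips_val ξ l).1.length_eq] using hlen)
  rw [(sortTrips_val ξ l).1.length_eq] at h3
  have h4 := h3.trans (Nat.mul_le_mul_right _ hlen)
  simp only [greedyProg, bind_time, pure_time, ← hl]
  unfold greedyBound
  omega

/-! ### Termination of the local search -/

/-- Here `n` limits the number of calls of `localSwap`, including the last one, which halts. The
second alternative is refuted by `no_long_chain` for suitable `n`. -/
theorem exists_localSearch_or_chain (ε : ℚ) {B : ℕ} (hB : ∀ S, (I.localSwap alg ε S).time ≤ B)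
    (n : ℕ) (S : Finset (Fin I.nA)) :
    (∃ S' t, LocalSearch alg I ε S S' t ∧ t ≤ n * B ∧
      Relation.ReflTransGen (fun S₁ S₂ => (I.localSwap alg ε S₁).val = some S₂) S S' ∧
      (I.localSwap alg ε S').val = none) ∨
    ∃ f : ℕ → Finset (Fin I.nA), f 0 = S ∧
      ∀ j < n, (I.localSwap alg ε (f j)).val = some (f (j + 1)) := by
  induction n generalizing S with
  | zero => exact Or.inr ⟨fun _ => S, rfl, fun j hj => absurd hj (by omega)⟩
  | succ n ih =>
    have ht := hB S
    rcases hS : (I.localSwap alg ε S).val with _ | S₁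
    · refine Or.inl ⟨S, (I.localSwap alg ε S).time, LocalSearch.halt ?_, ?_, .refl, hS⟩
      · rw [← hS]
      · rw [add_one_mul]
        omega
    · rcases ih S₁ with ⟨S', t, hrun, hle, hpath, hnone⟩ | ⟨f, hf0, hf⟩
      · refine Or.inl ⟨S', (I.localSwap alg ε S).time + t, LocalSearch.step (S₁ := S₁) ?_ hrun, ?_,
          .head hS hpath, hnone⟩
        · rw [← hS]
        · rw [add_one_mul]
          omega
      · refine Or.inr ⟨fun j => Nat.casesOn j S f, rfl, fun j hj => ?_⟩
        cases j with
        | zero => exact hS.trans (by rw [← hf0])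
        | succ j => exact hf j (by omega)

theorem value_le_two_pow (e : Fin (I.nE ξ)) : (I.value ξ e : ℝ) ≤ 2 ^ I.size := by
  have h1 : bits (I.value ξ e) ≤ I.size := by
    have := I.trip_le ξ e
    omega
  have h2 := natAbs_num_lt_of_bits_le h1
  have h3 : I.value ξ e ≤ ((I.value ξ e).num.natAbs : ℚ) := by
    have h4 := Rat.num_nonneg.2 (I.value_nonneg ξ e)
    have h5 : (((I.value ξ e).num.natAbs : ℤ) : ℚ) = (I.value ξ e).num := by
      rw [Int.natAbs_of_nonneg h4]
    rw [← Int.cast_natCast, h5]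
    conv_lhs => rw [← Rat.num_div_den (I.value ξ e)]
    exact div_le_self (by exact_mod_cast h4) (by exact_mod_cast (I.value ξ e).den_pos)
  have h6 : I.value ξ e ≤ ((2 ^ I.size : ℕ) : ℚ) := h3.trans (by exact_mod_cast h2.le)
  exact_mod_cast h6

/-- A positive rational is at least the reciprocal of its denominator. -/
theorem two_pow_inv_le_value (e : Fin (I.nE ξ)) (h0 : 0 < I.value ξ e) :
    ((2 : ℝ) ^ I.size)⁻¹ ≤ (I.value ξ e : ℝ) := by
  have h1 : bits (I.value ξ e) ≤ I.size := by
    have := I.trip_le ξ e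
    omega
  have h2 := den_lt_of_bits_le h1
  have h3 : ((2 ^ I.size : ℕ) : ℚ)⁻¹ ≤ I.value ξ e := by
    have h4 : (1 : ℚ) ≤ (I.value ξ e).num := by exact_mod_cast Rat.num_pos.2 h0
    have h5 : (0 : ℚ) < (I.value ξ e).den := by exact_mod_cast (I.value ξ e).den_pos
    conv_rhs => rw [← Rat.num_div_den (I.value ξ e)]
    calc ((2 ^ I.size : ℕ) : ℚ)⁻¹ ≤ ((I.value ξ e).den : ℚ)⁻¹ :=
          inv_anti₀ h5 (by exact_mod_cast h2.le)
      _ ≤ _ := by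
          rw [inv_eq_one_div]
          exact div_le_div_of_nonneg_right h4 h5.le
  have h4 : ((((2 ^ I.size : ℕ) : ℚ)⁻¹ : ℚ) : ℝ) ≤ (I.value ξ e : ℝ) := by exact_mod_cast h3
  simpa using h4

/-- The number of vehicles times N, the largest value and the reciprocal of the least positive value
are each at most `2 ^ I.size`, while every `p * K ^ 2` swaps after the first double the value. So `3
* I.size + 1` doublings are too many. -/
theorem no_long_chain (f : ℕ → Finset (Fin I.nA)) :
    ¬ ∀ j < I.p * I.K ^ 2 * (3 * I.size + 1) + 1,
      I.toReal.ImprovingSwap (I.eps : ℝ) (f j) (f (j + 1)) := by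
  intro hf
  have hε : (0 : ℝ) < (I.eps : ℝ) := by exact_mod_cast I.eps_pos
  have h2 : (0 : ℝ) < 2 ^ I.size := by positivity
  have h1 := pow_mul_vmin_le (I := I.toReal) (vmin := (2 ^ I.size)⁻¹) (vmax := 2 ^ I.size) hε.le
    (fun ξ e h0 => I.two_pow_inv_le_value ξ e (by
      have h0' : (0 : ℝ) < (I.value ξ e : ℝ) := h0
      exact_mod_cast h0'))
    (fun ξ e => I.value_le_two_pow ξ e) h2.le hf
  rw [← div_eq_mul_inv, div_le_iff₀ h2] at h1
  -- Bernoulli's inequality, with `p * K ^ 2 * ε = 1`.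
  have h3 : (2 : ℝ) ≤ (1 + (I.eps : ℝ)) ^ (I.p * I.K ^ 2) := by
    have hpK : (0 : ℝ) < (I.p : ℝ) * (I.K : ℝ) ^ 2 := by
      have hp : (0 : ℝ) < I.p := by exact_mod_cast I.p_pos
      have hK : (0 : ℝ) < I.K := by exact_mod_cast I.K_pos
      positivity
    have h4 := one_add_mul_le_pow (a := (I.eps : ℝ)) (by linarith) (I.p * I.K ^ 2)
    have h5 : ((I.p * I.K ^ 2 : ℕ) : ℝ) * (I.eps : ℝ) = 1 := by
      simp only [eps]
      push_cast
      exact mul_one_div_cancel hpK.ne'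
    linarith
  have h4 : (2 : ℝ) ^ (3 * I.size + 1) ≤
      (1 + (I.eps : ℝ)) ^ (I.p * I.K ^ 2 * (3 * I.size + 1)) := by
    rw [pow_mul]
    exact pow_le_pow_left₀ (by norm_num) h3 _
  have h5 : (I.N : ℝ) * ((I.nA : ℝ) + I.nB) ≤ 2 ^ I.size := by
    have h6 : I.N * (I.nA + I.nB) ≤ 2 ^ I.size := by
      calc I.N * (I.nA + I.nB) ≤ 2 ^ I.N * 2 ^ (I.nA + I.nB) :=
            Nat.mul_le_mul Nat.lt_two_pow_self.le Nat.lt_two_pow_self.le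
        _ = 2 ^ (I.N + (I.nA + I.nB)) := (pow_add _ _ _).symm
        _ ≤ 2 ^ I.size := Nat.pow_le_pow_right (by norm_num) (by unfold size; omega)
    exact_mod_cast h6
  have h6 : (2 : ℝ) ^ (3 * I.size + 1) ≤ 2 ^ I.size * 2 ^ I.size * 2 ^ I.size := by
    refine (h4.trans h1).trans ?_
    exact mul_le_mul_of_nonneg_right (mul_le_mul_of_nonneg_right h5 h2.le) h2.le
  have h7 : (2 : ℝ) ^ (3 * I.size + 1) = 2 * (2 ^ I.size * 2 ^ I.size * 2 ^ I.size) := by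
    ring
  have h8 : (0 : ℝ) < 2 ^ I.size * 2 ^ I.size * 2 ^ I.size := by positivity
  linarith

theorem exists_runs (halg : IsLPAlgorithm alg)
    (hT : ∀ S ξ, (alg (I.buildLP S ξ).val).time ≤ T) (S₀ : Finset (Fin I.nA))
    (hS₀ : S₀.card = I.K) :
    ∃ (S : Finset (Fin I.nA)) (A : ∀ ξ, Finset (Fin (I.nE ξ))) (t : ℕ),
      Runs alg I I.eps S₀ S A t ∧ t ≤ runBound I.size T ∧
      I.toReal.IsOutput (I.eps : ℝ) S₀ S A := by
  rcases I.exists_localSearch_or_chain I.eps (fun S => I.localSwap_time_le S halg hT)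
    (I.p * I.K ^ 2 * (3 * I.size + 1) + 1) S₀ with ⟨S, t, hrun, ht, hpath, hnone⟩ | ⟨f, -, hf⟩
  · refine ⟨S, (table fun ξ => I.greedyProg S ξ).val, _, ⟨t, hrun, rfl, rfl⟩, ?_, hS₀, ?_, ?_, ?_⟩
    · have hp : I.p ≤ I.size := by
        unfold size
        omega
      have hK : I.K ≤ I.size := I.K_le.trans I.nA_le
      have h1 : I.p * I.K ^ 2 * (3 * I.size + 1) + 1 ≤
          I.size * I.size ^ 2 * (3 * I.size + 1) + 1 := by
        gcongr
      have h2 := ht.trans (Nat.mul_le_mul_right _ h1)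
      have h3 : (table fun ξ => I.greedyProg S ξ).time ≤ I.size * (greedyBound I.size + 1) := by
        have h4 := Finset.sum_le_sum fun ξ (_ : ξ ∈ (Finset.univ : Finset (Fin I.N))) =>
          Nat.add_le_add_right (I.greedyProg_time_le S ξ) 1
        rw [Finset.sum_const, Finset.card_univ, Fintype.card_fin, smul_eq_mul] at h4
        exact h4.trans (Nat.mul_le_mul_right _ I.N_le)
      unfold runBound
      omega
    · exact Relation.ReflTransGen.mono (fun _ _ h => improvingSwap_of_localSwap halg h) _ _ hpath
    · exact fun S' => halted_of_localSwap halg hnone S'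
    · exact fun ξ => isGreedy_greedyProg ξ
  · exact absurd (fun j hj => improvingSwap_of_localSwap halg (hf j hj)) (I.no_long_chain f)

end Instance

/-! ### From bounds to a polynomial in the input length. -/

theorem monotone_eval (q : Polynomial ℕ) : Monotone fun n => q.eval n := by
  intro a b h
  simp only [Polynomial.eval_eq_sum_range]
  gcongr

theorem eval_lpSizeBound (n : ℕ) : (lpSizeBound (Polynomial.X : Polynomial ℕ)).eval n =
    lpSizeBound n := by
  simp [lpSizeBound]

theorem eval_runBound (Q : Polynomial ℕ) (n : ℕ) :
    (runBound Polynomial.X Q).eval n = runBound n (Q.eval n) := by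
  simp [runBound, localSwapBound, greedyBound, acceptBound, vHatBound, avgBits, sumBits,
    buildBound]

end SRAMF
theorem mainTheorem1 :
    -- approximation ratio, for every output of the algorithm
    (∀ (I : SRAMF.Instance ℝ) (S₀ S : Finset (Fin I.nA)) (A : ∀ ξ, Finset (Fin (I.nE ξ))),
      I.IsOutput (I.eps : ℝ) S₀ S A →
        S.card = I.K ∧
        (∀ ξ, I.Feasible S ξ (I.indicator ξ (A ξ))) ∧
        ∀ S' : Finset (Fin I.nA), S'.card ≤ I.K →
          1 / (I.p : ℝ) * I.vHat S' ≤ I.vHat S ∧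
          1 / (I.p : ℝ) ^ 2 * I.vStar S' ≤ I.outputValue A) ∧
    -- number of iterations of the local search
    (∀ (I : SRAMF.Instance ℝ) (vmin vmax : ℝ), 0 < vmin → vmin ≤ vmax →
      (∀ ξ e, 0 < I.value ξ e → vmin ≤ I.value ξ e) → (∀ ξ e, I.value ξ e ≤ vmax) →
      ∀ (k : ℕ) (S : ℕ → Finset (Fin I.nA)), (S 0).card = I.K →
        (∀ j < k, I.ImprovingSwap (I.eps : ℝ) (S j) (S (j + 1))) →
        (k : ℝ) ≤ 1 + Real.logb (1 + (I.eps : ℝ))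
          ((I.N : ℝ) * ((I.nA : ℝ) + (I.nB : ℝ)) * vmax / vmin)) ∧
    -- running time, with any polynomial-time LP algorithm as a subroutine
    (∀ q : Polynomial ℕ, ∃ P : Polynomial ℕ, ∀ alg : SRAMF.LP → SRAMF.Timed ℚ,
      SRAMF.IsLPAlgorithm alg → (∀ L : SRAMF.LP, (alg L).time ≤ q.eval L.size) →
      ∀ (I : SRAMF.Instance ℚ) (S₀ : Finset (Fin I.nA)), S₀.card = I.K →
        ∃ (S : Finset (Fin I.nA)) (A : ∀ ξ, Finset (Fin (I.nE ξ))) (t : ℕ),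
          SRAMF.Instance.Runs alg I I.eps S₀ S A t ∧ t ≤ P.eval I.size ∧
          I.toReal.IsOutput (I.eps : ℝ) S₀ S A) := by

  refine ⟨fun I S₀ S A h => ⟨?_, fun ξ => (h.greedy ξ).feasible, fun S' hS' => h.ratio S' hS'⟩,
    fun I vmin vmax h0 hle hmin hmax k T _ hT =>
      SRAMF.Instance.swaps_le h0 hle hmin hmax k T hT, fun q => ?_⟩
  · exact (SRAMF.Instance.card_eq_of_path h.path).trans h.card_start
  -- The LPs have length at most `lpSizeBound` of the input length, so `q` composed with it bounds
  -- each LP call and takes the place of `T`.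
  · refine ⟨SRAMF.runBound Polynomial.X (q.comp (SRAMF.lpSizeBound Polynomial.X)),
      fun alg halg hq I S₀ hS₀ => ?_⟩
    rw [SRAMF.eval_runBound, Polynomial.eval_comp, SRAMF.eval_lpSizeBound]
    exact I.exists_runs halg
      (fun S ξ => (hq _).trans (SRAMF.monotone_eval q (I.size_buildLP_le S ξ))) S₀ hS₀
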